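/- Let $V$ (state space) and $W$ (data space) be separable real Hilbert spaces, each of finite or infinite dimension. For $u,v\in V$ let $u\otimes v$ denote the operator $w\mapsto u\langle v,w\rangle$, and let $|\cdot|$ denote the norm of $V$, of $W$, or the operator norm. For each time $k\ge 1$ let $M^{(k)}:V\to V$ and $H^{(k)}:V\to W$ be bounded linear operators, $b^{(k)}\in V$, $d^{(k)}\in W$, and let $R^{(k)}$ be a bounded operator on $W$ with $R^{(k)}>0$, that is, symmetric and bounded below ($\langle R^{(k)}w,w\rangle\ge\alpha|w|^2$ for all $w$ and some $\alpha>0$). Put $$\mathcal K^{(k)}(Q)=QH^{(k)*}\bigl(H^{(k)}QH^{(k)*}+R^{(k)}\bigr)^{-1},\quad \mathcal B^{(k)}(x,Q)=x+\mathcal K^{(k)}(Q)(d^{(k)}-H^{(k)}x),\quad \mathcal A^{(k)}(Q)=Q-\mathcal K^{(k)}(Q)H^{(k)}Q .$$ Let $\mu_0$ be a probability distribution on $V$ with all moments finite, $\int|x|^q\,d\mu_0(x)<\infty$ for all $1\le q<\infty$. The \emph{Kalman filter} has the initial analysis mean $\overline X^{(0),a}=E(X)$ and covariance $Q^{(0),a}=E\bigl((X-E(X))\otimes(X-E(X))\bigr)$,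 where $X\sim\mu_0$, and for $k\ge1$ $$\overline X^{(k),f}=M^{(k)}\overline X^{(k-1),a}+b^{(k)},\quad Q^{(k),f}=M^{(k)}Q^{(k-1),a}M^{(k)*},\quad \overline X^{(k),a}=\mathcal B^{(k)}(\overline X^{(k),f},Q^{(k),f}),\quad Q^{(k),a}=\mathcal A^{(k)}(Q^{(k),f}).$$ For an ensemble $\boldsymbol x=(x_1,\dots,x_N)$ in $V$ let $E_N(\boldsymbol x)=\frac1N\sum_i x_i$ and $C_N(\boldsymbol x)=\frac1N\sum_i(x_i-E_N(\boldsymbol x))\otimes(x_i-E_N(\boldsymbol x))$. An \emph{unbiased square root ensemble filter} with $N\ge1$ members consists of ensembles $\boldsymbol X_N^{(k),a}=(X^{(k),a}_1,\dots,X^{(k),a}_N)$, $k\ge0$, of $V$-valued random elements on a probability space such that $X^{(0),a}_1,\dots,X^{(0),a}_N$ are i.i.d. with distribution $\mu_0$ and, for every $k\ge1$, with the forecast ensemble $X_i^{(k),f}=M^{(k)}X_i^{(k-1),a}+b^{(k)}$, almost surely $$E_N(\boldsymbol X_N^{(k),a})=\mathcal B^{(k)}\bigl(E_N(\boldsymbol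 X_N^{(k),f}),C_N(\boldsymbol X_N^{(k),f})\bigr),\qquad C_N(\boldsymbol X_N^{(k),a})=\mathcal A^{(k)}\bigl(C_N(\boldsymbol X_N^{(k),f})\bigr).$$ Then for all $k\ge0$ and $1\le p<\infty$, the ensemble mean and covariance of any unbiased square root ensemble filter converge in $L^p$ to the mean and covariance of the Kalman filter as $N\to\infty$, and for all $N=1,2,\dots$ $$\bigl(E\,|E_N(\boldsymbol X_N^{(k),a})-\overline X^{(k),a}|^p\bigr)^{1/p}\le\frac{C}{\sqrt N},\qquad \bigl(E\,|C_N(\boldsymbol X_N^{(k),a})-Q^{(k),a}|^p\bigr)^{1/p}\le\frac{C}{\sqrt N},$$ where the constant $C$ depends only on $p$, $k$, upper bounds for the norms $|M^{(j)}|,|b^{(j)}|,|H^{(j)}|,|(R^{(j)})^{-1}|,|d^{(j)}|$, $1\le j\le k$, and upper bounds for the moments $\int|x|^q\,d\mu_0(x)$, $1\le q<\infty$; in particular, it depends neither on the spaces $V$, $W$ and their dimensions, nor on the ensemble size $N$, nor on the particular filter. -/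

import Mathlib

open MeasureTheory ProbabilityTheory Filter Topology

noncomputable section

namespace EnsembleFilter

/-- `A > 0` for a bounded operator on a Hilbert space: symmetric and bounded below. -/
def IsPosDef {W : Type*} [NormedAddCommGroup W] [InnerProductSpace ℝ W]
    (A : W →L[ℝ] W) : Prop :=
  (∀ u v : W, inner ℝ (A u) v = inner ℝ u (A v)) ∧
    ∃ α : ℝ, 0 < α ∧ ∀ u : W, α * ‖u‖ ^ 2 ≤ inner ℝ (A u) u

/-- The deterministic inputs of the filtering problem on the state space `V` and the data space
`W`, at times `k = 1, 2, …` (the values at `k = 0` play no role): the affine model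
`x ↦ M k x + b k`, the observation operator `H k`, the data error covariance `R k > 0` and the
data vector `d k`. -/
structure Problem (V W : Type*) [NormedAddCommGroup V] [InnerProductSpace ℝ V]
    [NormedAddCommGroup W] [InnerProductSpace ℝ W] where
  M : ℕ → V →L[ℝ] V
  b : ℕ → V
  H : ℕ → V →L[ℝ] W
  R : ℕ → W →L[ℝ] W
  d : ℕ → W
  R_pos : ∀ k, 1 ≤ k → IsPosDef (R k)

section Analysis

variable {V W : Type*} [NormedAddCommGroup V] [InnerProductSpace ℝ V] [CompleteSpace V]
  [NormedAddCommGroup W] [InnerProductSpace ℝ W] [CompleteSpace W]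

/-- Kalman gain `𝒦(Q) = Q H* (H Q H* + R)⁻¹`. -/
def gain (H : V →L[ℝ] W) (R : W →L[ℝ] W) (Q : V →L[ℝ] V) : W →L[ℝ] V :=
  Q ∘L H.adjoint ∘L Ring.inverse (H ∘L Q ∘L H.adjoint + R)

/-- Analysis mean `ℬ(x, Q) = x + 𝒦(Q) (d - H x)`. -/
def analysisMean (H : V →L[ℝ] W) (R : W →L[ℝ] W) (d : W) (x : V) (Q : V →L[ℝ] V) : V :=
  x + gain H R Q (d - H x)

/-- Analysis covariance `𝒜(Q) = Q - 𝒦(Q) H Q`. -/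
def analysisCov (H : V →L[ℝ] W) (R : W →L[ℝ] W) (Q : V →L[ℝ] V) : V →L[ℝ] V :=
  Q - gain H R Q ∘L H ∘L Q

/-- The Kalman filter started from the mean `m₀` and the covariance `B`: the pair of the analysis
mean and the analysis covariance at time `k`. -/
def kalman (S : Problem V W) (m₀ : V) (B : V →L[ℝ] V) : ℕ → V × (V →L[ℝ] V)
  | 0 => (m₀, B)
  | k + 1 =>
    let xf : V := S.M (k + 1) (kalman S m₀ B k).1 + S.b (k + 1)
    let Qf : V →L[ℝ] V := S.M (k + 1) ∘L (kalman S m₀ B k).2 ∘L (S.M (k + 1)).adjoint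
    (analysisMean (S.H (k + 1)) (S.R (k + 1)) (S.d (k + 1)) xf Qf,
      analysisCov (S.H (k + 1)) (S.R (k + 1)) Qf)

end Analysis

section Ensemble

variable {V : Type*} [NormedAddCommGroup V] [InnerProductSpace ℝ V]

/-- Ensemble mean `(1/N) ∑ xᵢ`. -/
def ensMean {N : ℕ} (x : Fin N → V) : V := (N : ℝ)⁻¹ • ∑ i, x i

/-- Ensemble covariance `(1/N) ∑ (xᵢ - x̄) ⊗ (xᵢ - x̄)`. -/
def ensCov {N : ℕ} (x : Fin N → V) : V →L[ℝ] V :=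
  (N : ℝ)⁻¹ • ∑ i, InnerProductSpace.rankOne ℝ (x i - ensMean x) (x i - ensMean x)

/-- Mean of a distribution on `V`. -/
def distMean [MeasurableSpace V] (μ : Measure V) : V := ∫ x, x ∂μ

/-- Covariance of a distribution on `V`: the expectation of `(x - E x) ⊗ (x - E x)`. -/
def distCov [MeasurableSpace V] (μ : Measure V) : V →L[ℝ] V :=
  ∫ x, InnerProductSpace.rankOne ℝ (x - distMean μ) (x - distMean μ) ∂μ

end Ensemble

/-- `X k i` is the `i`-th member of the analysis ensemble at time `k` of a run, with `N` members,
of an unbiased square root ensemble filter: the initial ensemble is an i.i.d. sample from `μ₀`, and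
the analysis ensemble at each later time is any ensemble of random elements whose ensemble mean and
covariance are obtained from those of the forecast ensemble by the Kalman update. -/
structure IsUnbiasedSqrtFilter {V W Ω : Type*}
    [NormedAddCommGroup V] [InnerProductSpace ℝ V] [CompleteSpace V] [MeasurableSpace V]
    [NormedAddCommGroup W] [InnerProductSpace ℝ W] [CompleteSpace W]
    [MeasurableSpace Ω] (S : Problem V W) (μ₀ : Measure V) (P : Measure Ω) {N : ℕ}
    (X : ℕ → Fin N → Ω → V) : Prop where
  aemeasurable : ∀ k i, AEMeasurable (X k i) P
  indep : iIndepFun (X 0) P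
  law : ∀ i, HasLaw (X 0 i) μ₀ P
  mean : ∀ k, ∀ᵐ ω ∂P,
    let Xf : Fin N → V := fun i => S.M (k + 1) (X k i ω) + S.b (k + 1)
    ensMean (fun i => X (k + 1) i ω) =
      analysisMean (S.H (k + 1)) (S.R (k + 1)) (S.d (k + 1)) (ensMean Xf) (ensCov Xf)
  cov : ∀ k, ∀ᵐ ω ∂P,
    let Xf : Fin N → V := fun i => S.M (k + 1) (X k i ω) + S.b (k + 1)
    ensCov (fun i => X (k + 1) i ω) =
      analysisCov (S.H (k + 1)) (S.R (k + 1)) (ensCov Xf)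

end EnsembleFilter

end

/-!
The pair of the ensemble mean and the ensemble covariance evolves exactly by the Kalman step, a
deterministic map. By Joseph's form of the analysis covariance this map preserves positivity, and on
positive covariances it is Lipschitz up to a quadratic term in the distance to a bounded point, with
constants depending only on bounds for the inputs, since the inverse of `H Q H* + R` is bounded by
that of `R`. An error of order `1 / √N` in `L^{2q}` at time `k` thus gives one in `L^q` at time
`k + 1`, and `k` steps require the error at time `0` in `L^{2^k q}` only.

At time `0` the estimate is a Monte Carlo bound in a Hilbert space, where the even moments of a sum
of independent centred vectors are controlled by induction, because the first order term in the
expansion of `‖y + s‖ ^ (2 * n)` has mean zero. Operators do not form a Hilbert space, so the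
covariance is treated in the Hilbert space tensor square of `V`, whose norm dominates the operator
norm.
-/

noncomputable section

namespace EnsembleFilter

section EvenMoments

theorem pow_succ_le_of_sub_sq_le {x y M δ : ℝ} (hx : 0 ≤ x) (hy : 0 ≤ y) (hδ : 0 ≤ δ)
    (hxM : x ≤ M) (hyM : y ≤ M) (hxy : (y - x) ^ 2 ≤ δ * M) (n : ℕ) :
    y ^ (n + 1) ≤ x ^ (n + 1) + (n + 1) * x ^ n * (y - x) + (n + 1) ^ 2 * (δ * M ^ n) := by
  have hM : 0 ≤ M := hx.trans hxM
  induction n with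
  | zero => norm_num; linarith
  | succ n ih =>
    have hIH := mul_le_mul_of_nonneg_left ih hy
    have hsq : x ^ n * (y - x) ^ 2 ≤ M ^ n * (δ * M) := by gcongr
    have hy' : y * (δ * M ^ n) ≤ M * (δ * M ^ n) := by gcongr
    have : 0 ≤ δ * M ^ (n + 1) := by positivity
    push_cast
    calc y ^ (n + 1 + 1)
        ≤ x ^ (n + 2) + (n + 2) * x ^ (n + 1) * (y - x) + (n + 1) * (x ^ n * (y - x) ^ 2)
            + (n + 1) ^ 2 * (y * (δ * M ^ n)) := by linear_combination hIH
      _ ≤ x ^ (n + 2) + (n + 2) * x ^ (n + 1) * (y - x) + (n + 1) * (M ^ n * (δ * M))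
            + (n + 1) ^ 2 * (M * (δ * M ^ n)) := by gcongr
      _ = x ^ (n + 2) + (n + 2) * x ^ (n + 1) * (y - x)
            + ((n + 1) + (n + 1) ^ 2) * (δ * M ^ (n + 1)) := by ring
      _ ≤ x ^ (n + 2) + (n + 2) * x ^ (n + 1) * (y - x) + (n + 2) ^ 2 * (δ * M ^ (n + 1)) := by
        gcongr; nlinarith [n.cast_nonneg (α := ℝ)]
      _ = _ := by ring

/-- The constant of the second order expansion of `‖·‖ ^ (2 * (n + 1))`. -/
def normPowConst (n : ℕ) : ℝ := (n + 1) + (n + 1) ^ 2 * 4 ^ (n + 1)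

theorem normPowConst_nonneg (n : ℕ) : 0 ≤ normPowConst n := by unfold normPowConst; positivity

theorem norm_add_pow_le {G : Type*} [NormedAddCommGroup G] [InnerProductSpace ℝ G] (y s : G)
    (n : ℕ) :
    ‖y + s‖ ^ (2 * (n + 1)) ≤ ‖s‖ ^ (2 * (n + 1))
      + 2 * (n + 1) * inner ℝ y (‖s‖ ^ (2 * n) • s)
      + normPowConst n * (‖y‖ ^ 2 * ‖s‖ ^ (2 * n) + ‖y‖ ^ (2 * (n + 1))) := by
  have hexp : ‖y + s‖ ^ 2 - ‖s‖ ^ 2 = 2 * inner ℝ y s + ‖y‖ ^ 2 := by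
    rw [norm_add_sq_real]; ring
  have hdiff : (‖y + s‖ ^ 2 - ‖s‖ ^ 2) ^ 2 ≤ 4 * ‖y‖ ^ 2 * (‖y‖ + ‖s‖) ^ 2 := by
    rw [show 4 * ‖y‖ ^ 2 * (‖y‖ + ‖s‖) ^ 2 = (2 * ‖y‖ * (‖y‖ + ‖s‖)) ^ 2 by ring]
    have := abs_le.1 (abs_real_inner_le_norm y s)
    rw [hexp]
    apply sq_le_sq'
    all_goals nlinarith [norm_nonneg y, norm_nonneg s]
  have htaylor := pow_succ_le_of_sub_sq_le (sq_nonneg ‖s‖) (sq_nonneg ‖y + s‖) (by positivity)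
    (pow_le_pow_left₀ (norm_nonneg s) (by linarith [norm_nonneg y]) 2)
    (pow_le_pow_left₀ (norm_nonneg (y + s)) (norm_add_le y s) 2) hdiff n
  have hsum : ((‖y‖ + ‖s‖) ^ 2) ^ n ≤ 4 ^ n * (‖s‖ ^ (2 * n) + ‖y‖ ^ (2 * n)) := by
    calc ((‖y‖ + ‖s‖) ^ 2) ^ n ≤ (2 * (‖y‖ ^ 2 + ‖s‖ ^ 2)) ^ n := by gcongr; exact add_sq_le
      _ = 2 ^ n * (‖y‖ ^ 2 + ‖s‖ ^ 2) ^ n := mul_pow ..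
      _ ≤ 2 ^ n * (2 ^ n * ((‖y‖ ^ 2) ^ n + (‖s‖ ^ 2) ^ n)) := by
        gcongr
        refine (add_pow_le (sq_nonneg _) (sq_nonneg _) n).trans ?_
        gcongr <;> norm_num
      _ = 4 ^ n * (‖s‖ ^ (2 * n) + ‖y‖ ^ (2 * n)) := by
        rw [show (4 : ℝ) = 2 * 2 by norm_num, mul_pow]; ring
  have hn : 0 ≤ (n + 1 : ℝ) * ‖y‖ ^ (2 * (n + 1)) := by positivity
  rw [hexp] at htaylor
  simp only [← pow_mul] at htaylor hsum
  calc ‖y + s‖ ^ (2 * (n + 1))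
      ≤ _ := htaylor
    _ ≤ ‖s‖ ^ (2 * (n + 1)) + (n + 1) * ‖s‖ ^ (2 * n) * (2 * inner ℝ y s + ‖y‖ ^ 2)
        + (n + 1) ^ 2 * (4 * ‖y‖ ^ 2 * (4 ^ n * (‖s‖ ^ (2 * n) + ‖y‖ ^ (2 * n)))) := by gcongr
    _ ≤ _ := by
      rw [real_inner_smul_right, normPowConst]
      linear_combination hn

theorem integrable_norm_pow_of_memLp {α G : Type*} [MeasurableSpace α] [NormedAddCommGroup G]
    {μ : Measure α} [IsFiniteMeasure μ] {f : α → G} {m n : ℕ} (hf : MemLp f n μ) (hmn : m ≤ n) :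
    Integrable (fun x => ‖f x‖ ^ m) μ :=
  (hf.mono_exponent (Nat.cast_le.2 hmn)).integrable_norm_pow'

theorem memLp_pi_sum {G : Type*} [NormedAddCommGroup G] {N : ℕ} {E : Fin N → Type*}
    [∀ i, MeasurableSpace (E i)] {μ : ∀ i, Measure (E i)} [∀ i, IsProbabilityMeasure (μ i)]
    {y : ∀ i, E i → G} {q : ENNReal}
    (hy : ∀ i, MemLp (y i) q (μ i)) : MemLp (fun x => ∑ i, y i (x i)) q (Measure.pi μ) :=
  memLp_finsetSum _ fun i _ => (hy i).comp_measurePreserving (measurePreserving_eval μ i)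

theorem integral_pi_succ_comp_sum {N : ℕ} {E : Fin (N + 1) → Type*}
    [∀ i, MeasurableSpace (E i)] (μ : ∀ i, Measure (E i)) [∀ i, SigmaFinite (μ i)]
    {G : Type*} [AddCommMonoid G] (y : ∀ i, E i → G) (F : G → ℝ) :
    ∫ x, F (∑ i, y i (x i)) ∂Measure.pi μ =
      ∫ z, F (y 0 z.1 + ∑ i : Fin N, y (Fin.succAbove 0 i) (z.2 i))
        ∂(μ 0).prod (Measure.pi fun i => μ (Fin.succAbove 0 i)) := by
  rw [← (measurePreserving_piFinSuccAbove μ 0).integral_comp'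
    (fun z : E 0 × (∀ i : Fin N, E (Fin.succAbove 0 i)) =>
      F (y 0 z.1 + ∑ i : Fin N, y (Fin.succAbove 0 i) (z.2 i)))]
  simp only [Fin.sum_univ_succAbove _ 0]
  rfl

variable {G : Type*} [NormedAddCommGroup G] [InnerProductSpace ℝ G] [CompleteSpace G]

theorem integral_norm_add_pow_le {E F : Type*} [MeasurableSpace E] [MeasurableSpace F]
    {μ : Measure E} {ν : Measure F} [IsProbabilityMeasure μ] [IsProbabilityMeasure ν]
    {f : E → G} {g : F → G} {n : ℕ} (hf : MemLp f (2 * (n + 1) : ℕ) μ)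
    (hg : MemLp g (2 * (n + 1) : ℕ) ν) (hf0 : ∫ x, f x ∂μ = 0) :
    ∫ z, ‖f z.1 + g z.2‖ ^ (2 * (n + 1)) ∂μ.prod ν ≤ ∫ x, ‖g x‖ ^ (2 * (n + 1)) ∂ν
      + normPowConst n * ((∫ x, ‖f x‖ ^ 2 ∂μ) * (∫ x, ‖g x‖ ^ (2 * n) ∂ν)
        + ∫ x, ‖f x‖ ^ (2 * (n + 1)) ∂μ) := by
  have hf1 : Integrable f μ := hf.integrable (by exact_mod_cast (by omega : 1 ≤ 2 * (n + 1)))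
  have hg1 : Integrable (fun x => ‖g x‖ ^ (2 * n) • g x) ν := by
    refine (integrable_norm_pow_of_memLp hg (m := 2 * n + 1) (by omega)).mono'
      ((hg.1.norm.pow _).smul hg.1) (.of_forall fun x => ?_)
    rw [norm_smul, norm_pow, norm_norm, pow_succ]
  have hcross : Integrable (fun z : E × F => inner ℝ (f z.1) (‖g z.2‖ ^ (2 * n) • g z.2))
      (μ.prod ν) :=
    hf1.op_fst_snd (op := inner ℝ) continuous_inner
      ⟨1, fun x y => by simpa using norm_inner_le_norm (𝕜 := ℝ) x y⟩ hg1
  have hcross0 : ∫ z : E × F, inner ℝ (f z.1) (‖g z.2‖ ^ (2 * n) • g z.2) ∂μ.prod ν = 0 := by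
    have := integral_prod_bilin (innerSL ℝ : G →L[ℝ] G →L[ℝ] ℝ) hf1 hg1
    rwa [hf0, map_zero, zero_apply] at this
  have hfp := (hf.comp_fst ν).integrable_norm_pow'
  have hgp := (hg.comp_snd μ).integrable_norm_pow'
  have hfg : Integrable (fun z : E × F => ‖f z.1‖ ^ 2 * ‖g z.2‖ ^ (2 * n)) (μ.prod ν) :=
    (integrable_norm_pow_of_memLp hf (by omega)).mul_prod
      (integrable_norm_pow_of_memLp hg (by omega))
  have hsum := ((hf.comp_fst ν).add (hg.comp_snd μ)).integrable_norm_pow'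
  refine (integral_mono hsum
    ((hgp.fun_add (hcross.const_mul _)).fun_add ((hfg.fun_add hfp).const_mul _))
    fun z => norm_add_pow_le (f z.1) (g z.2) n).trans_eq ?_
  rw [integral_add (hgp.fun_add (hcross.const_mul _)) ((hfg.fun_add hfp).const_mul _),
    integral_add hgp (hcross.const_mul _), integral_const_mul, integral_const_mul,
    integral_add hfg hfp, hcross0, integral_prod_mul (fun x => ‖f x‖ ^ 2) fun x => ‖g x‖ ^ (2 * n),
    integral_fun_fst fun x => ‖f x‖ ^ (2 * (n + 1)),
    integral_fun_snd fun x => ‖g x‖ ^ (2 * (n + 1))]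
  simp

/-- The constant in the bound for the moment of order `2 * n` of a sum of independent vectors. -/
def sumMomentConst : ℕ → ℝ
  | 0 => 1
  | n + 1 => normPowConst n * (sumMomentConst n + 1)

theorem sumMomentConst_nonneg : ∀ n, 0 ≤ sumMomentConst n
  | 0 => zero_le_one
  | n + 1 => mul_nonneg (normPowConst_nonneg n) (by linarith [sumMomentConst_nonneg n])

/-- The even case of the Marcinkiewicz–Zygmund inequality in a Hilbert space. -/
theorem integral_norm_sum_pow_le (n : ℕ) : ∀ {N : ℕ} {E : Fin N → Type*}
    [∀ i, MeasurableSpace (E i)] {μ : ∀ i, Measure (E i)} [∀ i, IsProbabilityMeasure (μ i)]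
    {y : ∀ i, E i → G} {κ : Fin N → ℝ}, (∀ i, MemLp (y i) (2 * n : ℕ) (μ i)) →
    (∀ i, ∫ x, y i x ∂μ i = 0) → (∀ i, 0 ≤ κ i) →
    (∀ i, ∀ j ≤ n, ∫ x, ‖y i x‖ ^ (2 * j) ∂μ i ≤ κ i ^ j) →
    ∫ x, ‖∑ i, y i (x i)‖ ^ (2 * n) ∂Measure.pi μ ≤ sumMomentConst n * (∑ i, κ i) ^ n := by
  induction n with
  | zero => intros; simp [sumMomentConst]
  | succ n ih =>
    intro N
    induction N with
    | zero => intros; simp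
    | succ N ihN =>
      intro E _ μ _ y κ hy hy0 hκ0 hκ
      have htail := memLp_pi_sum fun i : Fin N => hy (Fin.succAbove 0 i)
      have hS : 0 ≤ ∑ i : Fin N, κ (Fin.succAbove 0 i) := Finset.sum_nonneg fun i _ => hκ0 _
      have hlow := ih (fun i : Fin N => (hy (Fin.succAbove 0 i)).mono_exponent
        (by gcongr; omega)) (fun i => hy0 _) (fun i => hκ0 _) fun i j hj => hκ _ j (by omega)
      have htop := ihN (fun i : Fin N => hy (Fin.succAbove 0 i)) (fun i => hy0 _)
        (fun i => hκ0 _) fun i => hκ _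
      have h1 := hκ 0 1 (by omega)
      have h2 := hκ 0 (n + 1) le_rfl
      have hD := sumMomentConst_nonneg n
      have hc := normPowConst_nonneg n
      rw [Fin.sum_univ_succAbove κ 0,
        integral_pi_succ_comp_sum μ y fun v => ‖v‖ ^ (2 * (n + 1))]
      set S := ∑ i : Fin N, κ (Fin.succAbove 0 i)
      have hκ00 := hκ0 0
      calc _ ≤ _ := integral_norm_add_pow_le (hy 0) htail (hy0 0)
        _ ≤ sumMomentConst (n + 1) * S ^ (n + 1) + normPowConst n *
            (κ 0 ^ 1 * (sumMomentConst n * S ^ n) + κ 0 ^ (n + 1)) := by gcongr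
        _ = normPowConst n * (sumMomentConst n * ((κ 0 + S) * S ^ n)
            + (κ 0 ^ (n + 1) + S ^ (n + 1))) := by rw [sumMomentConst]; ring
        _ ≤ normPowConst n * (sumMomentConst n * ((κ 0 + S) * (κ 0 + S) ^ n)
            + (κ 0 + S) ^ (n + 1)) := by
          gcongr
          · linarith
          · exact pow_add_pow_le hκ00 hS n.succ_ne_zero
        _ = _ := by rw [sumMomentConst]; ring

end EvenMoments

section SampleMean

variable {α E G : Type*} [MeasurableSpace α] [MeasurableSpace E] [NormedAddCommGroup G]

theorem lpNorm_natCast_pow {f : α → G} {μ : Measure α} (hf : AEStronglyMeasurable f μ) {n : ℕ}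
    (hn : n ≠ 0) : lpNorm f n μ ^ n = ∫ x, ‖f x‖ ^ n ∂μ := by
  rw [lpNorm_eq_integral_norm_rpow_toReal (by exact_mod_cast hn) (ENNReal.natCast_ne_top n) hf]
  simp only [ENNReal.toReal_natCast, Real.rpow_natCast]
  exact Real.rpow_inv_natCast_pow (integral_nonneg fun _ => by positivity) hn

theorem lpNorm_mono_exponent {f : α → G} {μ : Measure α} [IsProbabilityMeasure μ]
    {p q : ENNReal} (hf : MemLp f q μ) (hpq : p ≤ q) : lpNorm f p μ ≤ lpNorm f q μ := by
  rw [← toReal_eLpNorm hf.1, ← toReal_eLpNorm hf.1]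
  exact ENNReal.toReal_mono hf.2.ne (eLpNorm_le_eLpNorm_of_exponent_le hpq hf.1)

theorem norm_integral_le_lpNorm [NormedSpace ℝ G] {f : α → G} {μ : Measure α}
    [IsProbabilityMeasure μ] {q : ENNReal} (hf : MemLp f q μ) (hq : 1 ≤ q) :
    ‖∫ x, f x ∂μ‖ ≤ lpNorm f q μ :=
  (norm_integral_le_integral_norm f).trans <|
    (lpNorm_one_eq_integral_norm hf.1).ge.trans (lpNorm_mono_exponent hf hq)

theorem lpNorm_sub_integral_le [NormedSpace ℝ G] {f : α → G} {μ : Measure α}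
    [IsProbabilityMeasure μ] {q : ENNReal} (hf : MemLp f q μ) (hq : 1 ≤ q) :
    lpNorm (fun x => f x - ∫ x, f x ∂μ) q μ ≤ 2 * lpNorm f q μ := by
  refine (lpNorm_sub_le hf hq (g := fun _ => ∫ x, f x ∂μ)).trans ?_
  rw [lpNorm_const (by positivity) (IsProbabilityMeasure.ne_zero μ), probReal_univ, Real.one_rpow,
    mul_one]
  linarith [norm_integral_le_lpNorm hf hq]

theorem eLpNorm_comp_of_iid {P : Measure α} [IsProbabilityMeasure P] {μ : Measure E} {ι : Type*}
    [Fintype ι] {X : ι → α → E} (hX : iIndepFun X P) (hlaw : ∀ i, HasLaw (X i) μ P)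
    {F : (ι → E) → G} (hF : AEStronglyMeasurable F (Measure.pi fun _ => μ)) (q : ENNReal) :
    eLpNorm (fun ω => F fun i => X i ω) q P = eLpNorm F q (Measure.pi fun _ => μ) := by
  have hmap : P.map (fun ω i => X i ω) = Measure.pi fun _ => μ := by
    rw [(iIndepFun_iff_map_fun_eq_pi_map fun i => (hlaw i).aemeasurable).1 hX]
    simp only [(hlaw _).map_eq]
  rw [← hmap] at hF ⊢
  exact (eLpNorm_map_measure hF (aemeasurable_pi_lambda _ fun i => (hlaw i).aemeasurable)).symm

variable [InnerProductSpace ℝ G] [CompleteSpace G] {μ : Measure E} [IsProbabilityMeasure μ]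

theorem lpNorm_pi_sum_le {y : E → G} {n : ℕ} (hn : n ≠ 0) (hy : MemLp y (2 * n : ℕ) μ)
    (hy0 : ∫ x, y x ∂μ = 0) (N : ℕ) :
    lpNorm (fun x : Fin N → E => ∑ i, y (x i)) (2 * n : ℕ) (Measure.pi fun _ => μ) ≤
      sumMomentConst n ^ ((2 * n : ℕ) : ℝ)⁻¹ * (√N * lpNorm y (2 * n : ℕ) μ) := by
  have hmoment (j : ℕ) (hj : j ≤ n) :
      ∫ x, ‖y x‖ ^ (2 * j) ∂μ ≤ (lpNorm y (2 * n : ℕ) μ ^ 2) ^ j := by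
    rcases eq_or_ne j 0 with rfl | hj0
    · simp
    · rw [← lpNorm_natCast_pow hy.1 (by omega), ← pow_mul]
      gcongr
      · exact lpNorm_nonneg
      · exact lpNorm_mono_exponent hy (by gcongr)
  have hD := sumMomentConst_nonneg n
  have hL : 0 ≤ lpNorm y (2 * n : ℕ) μ := lpNorm_nonneg
  rw [← pow_le_pow_iff_left₀ lpNorm_nonneg (by positivity) (by omega : 2 * n ≠ 0),
    lpNorm_natCast_pow (memLp_pi_sum fun _ => hy).1 (by omega), mul_pow,
    Real.rpow_inv_natCast_pow hD (by omega), pow_mul (√N * _), mul_pow √(N : ℝ),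
    Real.sq_sqrt N.cast_nonneg]
  simpa using integral_norm_sum_pow_le n (fun _ : Fin N => hy) (fun _ => hy0)
    (fun _ => sq_nonneg _) fun _ => hmoment

/-- The constant in the Monte Carlo error bound in `L^{2n}`. -/
def sampleMeanConst (n : ℕ) : ℝ := 2 * sumMomentConst n ^ ((2 * n : ℕ) : ℝ)⁻¹

theorem sampleMeanConst_nonneg (n : ℕ) : 0 ≤ sampleMeanConst n :=
  mul_nonneg zero_le_two (Real.rpow_nonneg (sumMomentConst_nonneg n) _)

theorem eLpNorm_sampleMean_sub_integral_le {P : Measure α} [IsProbabilityMeasure P] {N : ℕ}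
    (hN : N ≠ 0) {X : Fin N → α → E} (hX : iIndepFun X P) (hlaw : ∀ i, HasLaw (X i) μ P)
    {y : E → G} {n : ℕ} (hn : n ≠ 0) (hy : MemLp y (2 * n : ℕ) μ) :
    eLpNorm (fun ω => (N : ℝ)⁻¹ • ∑ i, y (X i ω) - ∫ x, y x ∂μ) (2 * n : ℕ) P ≤
      ENNReal.ofReal (sampleMeanConst n * lpNorm y (2 * n : ℕ) μ / √N) := by
  have hq : (1 : ENNReal) ≤ (2 * n : ℕ) := by exact_mod_cast (by omega : 1 ≤ 2 * n)
  set z : E → G := fun x => y x - ∫ x, y x ∂μ with hz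
  have hzLp : MemLp z (2 * n : ℕ) μ := hy.sub (memLp_const _)
  have hz0 : ∫ x, z x ∂μ = 0 := by
    rw [integral_sub (hy.integrable hq) (integrable_const _)]; simp
  have hN' : (0 : ℝ) < N := by positivity
  have hmean (x : Fin N → E) :
      (N : ℝ)⁻¹ • ∑ i, y (x i) - ∫ x, y x ∂μ = (N : ℝ)⁻¹ • ∑ i, z (x i) := by
    simp only [hz, Finset.sum_sub_distrib, Finset.sum_const, Finset.card_univ, Fintype.card_fin,
      ← Nat.cast_smul_eq_nsmul ℝ, smul_sub, inv_smul_smul₀ hN'.ne']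
  have hsum : MemLp (fun x : Fin N → E => (N : ℝ)⁻¹ • ∑ i, z (x i)) (2 * n : ℕ)
      (Measure.pi fun _ => μ) := (memLp_pi_sum fun _ => hzLp).const_smul _
  simp only [hmean]
  rw [eLpNorm_comp_of_iid hX hlaw hsum.1, ← ofReal_lpNorm hsum]
  refine ENNReal.ofReal_le_ofReal ?_
  calc lpNorm (fun x : Fin N → E => (N : ℝ)⁻¹ • ∑ i, z (x i)) (2 * n : ℕ) (Measure.pi fun _ => μ)
      = (N : ℝ)⁻¹ * lpNorm (fun x : Fin N → E => ∑ i, z (x i)) (2 * n : ℕ)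
          (Measure.pi fun _ => μ) := by
        refine (lpNorm_const_smul _ _ _).trans ?_; simp
    _ ≤ (N : ℝ)⁻¹ * (sumMomentConst n ^ ((2 * n : ℕ) : ℝ)⁻¹ *
          (√N * (2 * lpNorm y (2 * n : ℕ) μ))) := by
      gcongr
      refine (lpNorm_pi_sum_le hn hzLp hz0 N).trans ?_
      have := sumMomentConst_nonneg n
      gcongr
      exact lpNorm_sub_integral_le hy hq
    _ = _ := by
      rw [sampleMeanConst, div_eq_mul_inv, ← Real.sqrt_div_self]; ring

end SampleMean

section SquaredNorm

variable {α G F : Type*} [MeasurableSpace α] [NormedAddCommGroup G] [NormedAddCommGroup F]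
  {μ : Measure α} {f : α → G} {g : α → F}

theorem eLpNorm_of_norm_eq_sq (hgf : ∀ x, ‖g x‖ = ‖f x‖ ^ 2) (q : ENNReal) :
    eLpNorm g q μ = eLpNorm f (2 * q) μ ^ 2 := by
  have h := eLpNorm_norm_rpow (p := q) (μ := μ) f zero_lt_two
  simp only [Real.rpow_two, ENNReal.ofReal_ofNat, ENNReal.rpow_ofNat, mul_comm q, ← hgf] at h
  rw [← h, eLpNorm_norm]

theorem memLp_of_norm_eq_sq (hg : AEStronglyMeasurable g μ) (hgf : ∀ x, ‖g x‖ = ‖f x‖ ^ 2)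
    {q : ENNReal} (hf : MemLp f (2 * q) μ) : MemLp g q μ :=
  ⟨hg, by rw [eLpNorm_of_norm_eq_sq hgf]; exact ENNReal.pow_lt_top hf.2⟩

theorem lpNorm_of_norm_eq_sq (hg : AEStronglyMeasurable g μ) (hf : AEStronglyMeasurable f μ)
    (hgf : ∀ x, ‖g x‖ = ‖f x‖ ^ 2) (q : ENNReal) : lpNorm g q μ = lpNorm f (2 * q) μ ^ 2 := by
  rw [← toReal_eLpNorm hg, ← toReal_eLpNorm hf, eLpNorm_of_norm_eq_sq hgf, ENNReal.toReal_pow]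

end SquaredNorm

section Analysis

variable {V W : Type*} [NormedAddCommGroup V] [InnerProductSpace ℝ V]
  [NormedAddCommGroup W] [InnerProductSpace ℝ W]

theorem IsPosDef.isPositive {R : W →L[ℝ] W} (hR : IsPosDef R) : R.IsPositive := by
  obtain ⟨hsymm, α, hα, hcoercive⟩ := hR
  exact ContinuousLinearMap.isPositive_def.2
    ⟨hsymm, fun w => (by positivity : 0 ≤ α * ‖w‖ ^ 2).trans (hcoercive w)⟩

theorem IsPosDef.positive_add {T R : W →L[ℝ] W} (hT : T.IsPositive) (hR : IsPosDef R) :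
    IsPosDef (T + R) := by
  refine ⟨fun u v => (hT.add hR.isPositive).isSymmetric u v, ?_⟩
  obtain ⟨-, α, hα, hcoercive⟩ := hR
  refine ⟨α, hα, fun w => ?_⟩
  rw [add_apply, inner_add_left]
  linarith [hcoercive w, hT.inner_nonneg_left w]

variable [CompleteSpace W]

theorem IsPosDef.isUnit {R : W →L[ℝ] W} (hR : IsPosDef R) : IsUnit R := by
  obtain ⟨-, α, hα, hcoercive⟩ := hR
  refine R.isUnit_of_forall_le_norm_inner_map (c := ⟨α, hα.le⟩) hα fun w => ?_
  rw [mul_comm]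
  exact (hcoercive w).trans (le_abs_self _)

theorem IsPosDef.apply_inverse_apply {R : W →L[ℝ] W} (hR : IsPosDef R) (w : W) :
    R (Ring.inverse R w) = w := by
  rw [← mul_apply_eq_comp, Ring.mul_inverse_cancel _ hR.isUnit, one_apply_eq_self]

theorem IsPosDef.inner_inverse_apply {R : W →L[ℝ] W} (hR : IsPosDef R) (w : W) :
    inner ℝ (R w) (Ring.inverse R w) = ‖w‖ ^ 2 := by
  rw [hR.1, hR.apply_inverse_apply, real_inner_self_eq_norm_sq]

theorem IsPosDef.sq_norm_le {R : W →L[ℝ] W} (hR : IsPosDef R) (w : W) :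
    ‖w‖ ^ 2 ≤ ‖Ring.inverse R‖ * inner ℝ (R w) w := by
  set r := ‖Ring.inverse R‖
  set z := Ring.inverse R w
  have hwz : inner ℝ w z ≤ r * ‖w‖ ^ 2 := by
    calc inner ℝ w z ≤ ‖w‖ * ‖z‖ := real_inner_le_norm _ _
      _ ≤ ‖w‖ * (r * ‖w‖) := by gcongr; exact ContinuousLinearMap.le_opNorm _ _
      _ = r * ‖w‖ ^ 2 := by ring
  -- The form of `R` is nonnegative at `r w - R⁻¹ w`.
  have hpos : 0 ≤ r * (r * inner ℝ (R w) w - ‖w‖ ^ 2) := by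
    have h := hR.isPositive.inner_nonneg_left (r • w - z)
    simp only [map_sub, map_smul, inner_sub_left, inner_sub_right, real_inner_smul_left,
      real_inner_smul_right, hR.inner_inverse_apply, z, hR.apply_inverse_apply,
      real_inner_self_eq_norm_sq] at h
    linarith
  rcases (norm_nonneg (Ring.inverse R)).eq_or_lt with hr | hr
  · have hw : w = 0 := by
      rw [← hR.apply_inverse_apply w, norm_eq_zero.1 hr.symm, zero_apply, map_zero]
    simp [hw]
  · linarith [nonneg_of_mul_nonneg_right hpos hr]

theorem IsPosDef.norm_inverse_positive_add_le {T R : W →L[ℝ] W} (hT : T.IsPositive)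
    (hR : IsPosDef R) : ‖Ring.inverse (T + R)‖ ≤ ‖Ring.inverse R‖ := by
  refine ContinuousLinearMap.opNorm_le_bound _ (norm_nonneg _) fun w => ?_
  set u := Ring.inverse (T + R) w
  have hsq : ‖u‖ * ‖u‖ ≤ ‖Ring.inverse R‖ * ‖w‖ * ‖u‖ :=
    calc ‖u‖ * ‖u‖ = ‖u‖ ^ 2 := (sq _).symm
      _ ≤ ‖Ring.inverse R‖ * inner ℝ (R u) u := hR.sq_norm_le u
      _ ≤ ‖Ring.inverse R‖ * inner ℝ ((T + R) u) u := by
          rw [add_apply, inner_add_left]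
          gcongr
          exact le_add_of_nonneg_left (hT.inner_nonneg_left u)
      _ ≤ ‖Ring.inverse R‖ * (‖w‖ * ‖u‖) := by
          rw [(hR.positive_add hT).apply_inverse_apply]
          gcongr
          exact real_inner_le_norm w u
      _ = ‖Ring.inverse R‖ * ‖w‖ * ‖u‖ := (mul_assoc _ _ _).symm
  rcases (norm_nonneg u).eq_or_lt with hu | hu
  · rw [← hu]
    positivity
  · exact le_of_mul_le_mul_right hsq hu

variable [CompleteSpace V] {H : V →L[ℝ] W} {R : W →L[ℝ] W} {P Q : V →L[ℝ] V}

theorem isPosDef_innovation (H : V →L[ℝ] W) (hR : IsPosDef R) (hQ : Q.IsPositive) :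
    IsPosDef (H ∘L Q ∘L H.adjoint + R) :=
  hR.positive_add (hQ.conj_adjoint H)

theorem gain_innovation_apply (hR : IsPosDef R) (hQ : Q.IsPositive) (w : W) :
    gain H R Q ((H ∘L Q ∘L H.adjoint + R) w) = Q (H.adjoint w) := by
  have h := Ring.inverse_mul_cancel _ (isPosDef_innovation H hR hQ).isUnit
  simpa only [gain, ContinuousLinearMap.comp_apply, mul_apply_eq_comp, one_apply_eq_self] using
    congrArg (fun T : W →L[ℝ] W => Q (H.adjoint (T w))) h

theorem norm_gain_le (hR : IsPosDef R) (hQ : Q.IsPositive) :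
    ‖gain H R Q‖ ≤ ‖Q‖ * (‖H‖ * ‖Ring.inverse R‖) := by
  refine (ContinuousLinearMap.opNorm_comp_le _ _).trans ?_
  gcongr
  refine (ContinuousLinearMap.opNorm_comp_le _ _).trans ?_
  rw [LinearIsometryEquiv.norm_map]
  gcongr
  exact hR.norm_inverse_positive_add_le (hQ.conj_adjoint H)

theorem norm_id_sub_gain_comp_le (hR : IsPosDef R) (hQ : Q.IsPositive) :
    ‖ContinuousLinearMap.id ℝ V - gain H R Q ∘L H‖ ≤
      1 + ‖Q‖ * (‖H‖ * ‖Ring.inverse R‖) * ‖H‖ := by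
  refine (norm_sub_le _ _).trans (add_le_add ContinuousLinearMap.norm_id_le ?_)
  refine (ContinuousLinearMap.opNorm_comp_le _ _).trans ?_
  gcongr
  exact norm_gain_le hR hQ

/-- Joseph's form of the analysis covariance. -/
theorem analysisCov_eq_conj_add_conj (hR : IsPosDef R) (hQ : Q.IsPositive) :
    analysisCov H R Q =
      (ContinuousLinearMap.id ℝ V - gain H R Q ∘L H) ∘L Q ∘L
          (ContinuousLinearMap.id ℝ V - gain H R Q ∘L H).adjoint +
        gain H R Q ∘L R ∘L (gain H R Q).adjoint := by
  ext u
  have h := gain_innovation_apply (H := H) hR hQ ((gain H R Q).adjoint u)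
  simp only [analysisCov, add_apply, sub_apply, ContinuousLinearMap.comp_apply,
    ContinuousLinearMap.id_apply, map_add, map_sub, ContinuousLinearMap.adjoint_comp,
    ContinuousLinearMap.adjoint_id] at h ⊢
  rw [eq_sub_of_add_eq' h]
  abel

theorem isPositive_analysisCov (hR : IsPosDef R) (hQ : Q.IsPositive) :
    (analysisCov H R Q).IsPositive := by
  rw [analysisCov_eq_conj_add_conj hR hQ]
  exact (hQ.conj_adjoint _).add (hR.isPositive.conj_adjoint _)

theorem gain_sub_gain (hR : IsPosDef R) (hP : P.IsPositive) (hQ : Q.IsPositive) :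
    gain H R Q - gain H R P =
      (ContinuousLinearMap.id ℝ V - gain H R P ∘L H) ∘L (Q - P) ∘L H.adjoint ∘L
        Ring.inverse (H ∘L Q ∘L H.adjoint + R) := by
  ext w
  obtain ⟨z, hz⟩ : ∃ z, Ring.inverse (H ∘L Q ∘L H.adjoint + R) w = z := ⟨_, rfl⟩
  have hw : H (Q (H.adjoint z)) + R z = w :=
    hz ▸ (isPosDef_innovation H hR hQ).apply_inverse_apply w
  have hPz : gain H R P (H (P (H.adjoint z)) + R z) = P (H.adjoint z) :=
    gain_innovation_apply hR hP z
  have hQw : gain H R Q w = Q (H.adjoint z) := hz ▸ rfl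
  simp only [sub_apply, ContinuousLinearMap.comp_apply, ContinuousLinearMap.id_apply, map_sub, hz,
    hQw]
  rw [← hw]
  nth_rw 1 [← hPz]
  simp only [map_add]
  abel

theorem norm_gain_sub_gain_le (hR : IsPosDef R) (hP : P.IsPositive) (hQ : Q.IsPositive) :
    ‖gain H R Q - gain H R P‖ ≤
      (1 + ‖P‖ * (‖H‖ * ‖Ring.inverse R‖) * ‖H‖) * (‖Q - P‖ * (‖H‖ * ‖Ring.inverse R‖)) := by
  rw [gain_sub_gain hR hP hQ]
  refine (ContinuousLinearMap.opNorm_comp_le _ _).trans ?_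
  gcongr
  · exact norm_id_sub_gain_comp_le hR hP
  refine (ContinuousLinearMap.opNorm_comp_le _ _).trans ?_
  gcongr
  refine (ContinuousLinearMap.opNorm_comp_le _ _).trans ?_
  rw [LinearIsometryEquiv.norm_map]
  gcongr
  exact hR.norm_inverse_positive_add_le (hQ.conj_adjoint H)

theorem analysisMean_sub (H : V →L[ℝ] W) (R : W →L[ℝ] W) (d : W) (x y : V) (P Q : V →L[ℝ] V) :
    analysisMean H R d x Q - analysisMean H R d y P =
      (ContinuousLinearMap.id ℝ V - gain H R Q ∘L H) (x - y) +
        (gain H R Q - gain H R P) (d - H y) := by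
  simp only [analysisMean, sub_apply, map_sub, ContinuousLinearMap.comp_apply,
    ContinuousLinearMap.id_apply]
  abel

theorem analysisCov_sub (H : V →L[ℝ] W) (R : W →L[ℝ] W) (P Q : V →L[ℝ] V) :
    analysisCov H R Q - analysisCov H R P =
      (ContinuousLinearMap.id ℝ V - gain H R P ∘L H) ∘L (Q - P) -
        (gain H R Q - gain H R P) ∘L H ∘L Q := by
  ext u
  simp only [analysisCov, sub_apply, map_sub, ContinuousLinearMap.comp_apply,
    ContinuousLinearMap.id_apply]
  abel

theorem norm_analysisMean_sub_le (hR : IsPosDef R) (hP : P.IsPositive) (hQ : Q.IsPositive)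
    (d : W) (x y : V) :
    ‖analysisMean H R d x Q - analysisMean H R d y P‖ ≤
      (1 + ‖Q‖ * (‖H‖ * ‖Ring.inverse R‖) * ‖H‖) * ‖x - y‖ +
        (1 + ‖P‖ * (‖H‖ * ‖Ring.inverse R‖) * ‖H‖) * (‖Q - P‖ * (‖H‖ * ‖Ring.inverse R‖)) *
          (‖d‖ + ‖H‖ * ‖y‖) := by
  rw [analysisMean_sub]
  refine (norm_add_le _ _).trans (add_le_add ?_ ?_)
  · exact ContinuousLinearMap.le_of_opNorm_le _ (norm_id_sub_gain_comp_le hR hQ) _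
  · refine ContinuousLinearMap.le_of_opNorm_le_of_le _ (norm_gain_sub_gain_le hR hP hQ) ?_
    exact (norm_sub_le _ _).trans (by gcongr; exact H.le_opNorm y)

theorem norm_analysisCov_sub_le (hR : IsPosDef R) (hP : P.IsPositive) (hQ : Q.IsPositive) :
    ‖analysisCov H R Q - analysisCov H R P‖ ≤
      (1 + ‖P‖ * (‖H‖ * ‖Ring.inverse R‖) * ‖H‖) *
        (1 + ‖Q‖ * (‖H‖ * ‖Ring.inverse R‖) * ‖H‖) * ‖Q - P‖ := by
  set c := 1 + ‖P‖ * (‖H‖ * ‖Ring.inverse R‖) * ‖H‖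
  have hfst : ‖(ContinuousLinearMap.id ℝ V - gain H R P ∘L H) ∘L (Q - P)‖ ≤ c * ‖Q - P‖ :=
    (ContinuousLinearMap.opNorm_comp_le _ _).trans <| by
      gcongr
      exact norm_id_sub_gain_comp_le hR hP
  have hsnd : ‖(gain H R Q - gain H R P) ∘L H ∘L Q‖ ≤
      c * (‖Q - P‖ * (‖H‖ * ‖Ring.inverse R‖)) * (‖H‖ * ‖Q‖) :=
    (ContinuousLinearMap.opNorm_comp_le _ _).trans <| by
      gcongr
      · exact norm_gain_sub_gain_le hR hP hQ
      · exact ContinuousLinearMap.opNorm_comp_le _ _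
  rw [analysisCov_sub]
  refine (norm_sub_le _ _).trans ((add_le_add hfst hsnd).trans_eq ?_)
  ring

end Analysis

section Step

variable {V W : Type*} [NormedAddCommGroup V] [InnerProductSpace ℝ V]
  [NormedAddCommGroup W] [InnerProductSpace ℝ W] {S : Problem V W} {j k : ℕ}

/-- All the inputs at time `j`, and the inverse of the data error covariance, have norm at most
`L`. -/
structure Problem.BoundedAt (S : Problem V W) (j : ℕ) (L : ℝ) : Prop where
  M : ‖S.M j‖ ≤ L
  b : ‖S.b j‖ ≤ L
  H : ‖S.H j‖ ≤ L
  R : ‖Ring.inverse (S.R j)‖ ≤ L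
  d : ‖S.d j‖ ≤ L

theorem Problem.BoundedAt.mono {L A : ℝ} (hS : S.BoundedAt j L) (hLA : L ≤ A) :
    S.BoundedAt j A :=
  ⟨hS.M.trans hLA, hS.b.trans hLA, hS.H.trans hLA, hS.R.trans hLA, hS.d.trans hLA⟩

variable [CompleteSpace V] [CompleteSpace W]

/-- One cycle of the Kalman filter, forecast followed by analysis, from time `j - 1` to time `j`,
on pairs consisting of a mean and a covariance. -/
def Problem.step (S : Problem V W) (j : ℕ) (z : V × (V →L[ℝ] V)) : V × (V →L[ℝ] V) :=
  (analysisMean (S.H j) (S.R j) (S.d j) (S.M j z.1 + S.b j) (S.M j ∘L z.2 ∘L (S.M j).adjoint),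
    analysisCov (S.H j) (S.R j) (S.M j ∘L z.2 ∘L (S.M j).adjoint))

theorem kalman_succ (S : Problem V W) (m : V) (B : V →L[ℝ] V) (k : ℕ) :
    kalman S m B (k + 1) = S.step (k + 1) (kalman S m B k) :=
  rfl

theorem isPositive_step_snd (S : Problem V W) (hj : 1 ≤ j) {z : V × (V →L[ℝ] V)}
    (hz : z.2.IsPositive) : (S.step j z).2.IsPositive :=
  isPositive_analysisCov (S.R_pos j hj) (hz.conj_adjoint _)

theorem isPositive_kalman_snd (S : Problem V W) (m : V) {B : V →L[ℝ] V} (hB : B.IsPositive) :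
    ∀ k, (kalman S m B k).2.IsPositive
  | 0 => hB
  | k + 1 => isPositive_step_snd S k.succ_pos (isPositive_kalman_snd S m hB k)

theorem norm_conj_adjoint_le {M Q : V →L[ℝ] V} {A c : ℝ} (hM : ‖M‖ ≤ A) (hQ : ‖Q‖ ≤ c) :
    ‖M ∘L Q ∘L M.adjoint‖ ≤ A ^ 2 * c := by
  have hA : 0 ≤ A := (norm_nonneg M).trans hM
  have hc : 0 ≤ c := (norm_nonneg Q).trans hQ
  calc ‖M ∘L Q ∘L M.adjoint‖ ≤ ‖M‖ * (‖Q‖ * ‖M.adjoint‖) :=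
        (ContinuousLinearMap.opNorm_comp_le _ _).trans <| by
          gcongr
          exact ContinuousLinearMap.opNorm_comp_le _ _
    _ ≤ A * (c * A) := by
        rw [LinearIsometryEquiv.norm_map]
        gcongr
    _ = A ^ 2 * c := by ring

theorem one_add_mul_mul_mul_le {A e q h r : ℝ} (hA : 1 ≤ A) (hh₀ : 0 ≤ h) (hr₀ : 0 ≤ r)
    (he : 0 ≤ e) (hq : q ≤ A ^ 3 * (1 + e)) (hh : h ≤ A) (hr : r ≤ A) :
    1 + q * (h * r) * h ≤ 2 * A ^ 6 * (1 + e) :=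
  calc 1 + q * (h * r) * h ≤ 1 + A ^ 3 * (1 + e) * (A * A) * A := by gcongr
    _ = 1 + A ^ 6 * (1 + e) := by ring
    _ ≤ A ^ 6 * (1 + e) + A ^ 6 * (1 + e) := by
        gcongr
        exact one_le_mul_of_one_le_of_one_le (one_le_pow₀ hA) (le_add_of_nonneg_right he)
    _ = 2 * A ^ 6 * (1 + e) := by ring

section

variable {H : V →L[ℝ] W} {R : W →L[ℝ] W} {d : W} {x y : V} {P Q : V →L[ℝ] V} {A e : ℝ}

theorem norm_analysisMean_sub_le_of_le (hR : IsPosDef R) (hP : P.IsPositive) (hQ : Q.IsPositive)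
    (hA : 1 ≤ A) (hH : ‖H‖ ≤ A) (hr : ‖Ring.inverse R‖ ≤ A) (hd : ‖d‖ ≤ A)
    (hy : ‖y‖ ≤ 2 * A ^ 2) (hPA : ‖P‖ ≤ A ^ 3) (hQA : ‖Q‖ ≤ A ^ 3 * (1 + e))
    (hxy : ‖x - y‖ ≤ A * e) (hQP : ‖Q - P‖ ≤ A ^ 2 * e) :
    ‖analysisMean H R d x Q - analysisMean H R d y P‖ ≤ 8 * A ^ 14 * (e + e ^ 2) := by
  have he : 0 ≤ e := nonneg_of_mul_nonneg_right ((norm_nonneg _).trans hxy) (by positivity)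
  calc ‖analysisMean H R d x Q - analysisMean H R d y P‖
      ≤ 2 * A ^ 6 * (1 + e) * (A * e) +
          2 * A ^ 6 * (1 + 0) * (A ^ 2 * e * (A * A)) * (A + A * (2 * A ^ 2)) := by
        refine (norm_analysisMean_sub_le hR hP hQ d x y).trans ?_
        gcongr
        · exact one_add_mul_mul_mul_le hA (norm_nonneg _) (norm_nonneg _) he hQA hH hr
        · exact one_add_mul_mul_mul_le hA (norm_nonneg _) (norm_nonneg _) le_rfl
            (by simpa only [add_zero, mul_one] using hPA) hH hr
    _ = 2 * A ^ 7 * (e + e ^ 2) + 2 * A ^ 11 * e + 4 * A ^ 13 * e := by ring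
    _ ≤ 2 * A ^ 14 * (e + e ^ 2) + 2 * A ^ 14 * (e + e ^ 2) + 4 * A ^ 14 * (e + e ^ 2) := by
        have hee : e ≤ e + e ^ 2 := le_add_of_nonneg_right (sq_nonneg e)
        gcongr <;> first | exact hA | norm_num
    _ = 8 * A ^ 14 * (e + e ^ 2) := by ring

theorem norm_analysisCov_sub_le_of_le (hR : IsPosDef R) (hP : P.IsPositive) (hQ : Q.IsPositive)
    (hA : 1 ≤ A) (he : 0 ≤ e) (hH : ‖H‖ ≤ A) (hr : ‖Ring.inverse R‖ ≤ A) (hPA : ‖P‖ ≤ A ^ 3)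
    (hQA : ‖Q‖ ≤ A ^ 3 * (1 + e)) (hQP : ‖Q - P‖ ≤ A ^ 2 * e) :
    ‖analysisCov H R Q - analysisCov H R P‖ ≤ 8 * A ^ 14 * (e + e ^ 2) :=
  calc ‖analysisCov H R Q - analysisCov H R P‖
      ≤ 2 * A ^ 6 * (1 + 0) * (2 * A ^ 6 * (1 + e)) * (A ^ 2 * e) := by
        refine (norm_analysisCov_sub_le hR hP hQ).trans ?_
        gcongr
        · exact one_add_mul_mul_mul_le hA (norm_nonneg _) (norm_nonneg _) le_rfl
            (by simpa only [add_zero, mul_one] using hPA) hH hr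
        · exact one_add_mul_mul_mul_le hA (norm_nonneg _) (norm_nonneg _) he hQA hH hr
    _ = 4 * A ^ 14 * (e + e ^ 2) := by ring
    _ ≤ 8 * A ^ 14 * (e + e ^ 2) := by gcongr; norm_num

end

theorem norm_step_sub_step_le {A : ℝ} (hA : 1 ≤ A) (hj : 1 ≤ j) (hS : S.BoundedAt j A)
    {z z' : V × (V →L[ℝ] V)} (hz : z.2.IsPositive) (hz' : z'.2.IsPositive) (hz'A : ‖z'‖ ≤ A) :
    ‖S.step j z - S.step j z'‖ ≤ 8 * A ^ 14 * (‖z - z'‖ + ‖z - z'‖ ^ 2) := by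
  obtain ⟨hM, hb, hH, hr, hd⟩ := hS
  have hR := S.R_pos j hj
  have hQ := hz.conj_adjoint (S.M j)
  have hP := hz'.conj_adjoint (S.M j)
  set e := ‖z - z'‖
  set Q := S.M j ∘L z.2 ∘L (S.M j).adjoint
  set P := S.M j ∘L z'.2 ∘L (S.M j).adjoint
  have hmean : ‖(S.M j z.1 + S.b j) - (S.M j z'.1 + S.b j)‖ ≤ A * e := by
    rw [add_sub_add_right_eq_sub, ← map_sub]
    exact ContinuousLinearMap.le_of_opNorm_le_of_le _ hM (norm_fst_le (z - z'))
  have hmean' : ‖S.M j z'.1 + S.b j‖ ≤ 2 * A ^ 2 :=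
    calc ‖S.M j z'.1 + S.b j‖ ≤ A * A + A := (norm_add_le _ _).trans <| add_le_add
          (ContinuousLinearMap.le_of_opNorm_le_of_le _ hM ((norm_fst_le z').trans hz'A)) hb
      _ ≤ A * A + A * A := by gcongr; exact le_mul_of_one_le_left (by positivity) hA
      _ = 2 * A ^ 2 := by ring
  have hcov : ‖Q - P‖ ≤ A ^ 2 * e := by
    have hsub : Q - P = S.M j ∘L (z.2 - z'.2) ∘L (S.M j).adjoint := by
      ext u
      simp only [Q, P, sub_apply, ContinuousLinearMap.comp_apply, map_sub]
    rw [hsub]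
    exact norm_conj_adjoint_le hM (norm_snd_le (z - z'))
  have hPA : ‖P‖ ≤ A ^ 3 :=
    (norm_conj_adjoint_le hM ((norm_snd_le z').trans hz'A)).trans_eq (by ring)
  have hQA : ‖Q‖ ≤ A ^ 3 * (1 + e) :=
    calc ‖Q‖ ≤ ‖P‖ + ‖Q - P‖ := norm_le_norm_add_norm_sub' Q P
      _ ≤ A ^ 3 + A ^ 3 * e := by
          refine add_le_add hPA (hcov.trans ?_)
          gcongr
          norm_num
      _ = A ^ 3 * (1 + e) := by ring
  exact max_le (norm_analysisMean_sub_le_of_le hR hP hQ hA hH hr hd hmean' hPA hQA hmean hcov)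
    (norm_analysisCov_sub_le_of_le hR hP hQ hA (norm_nonneg _) hH hr hPA hQA hcov)

theorem step_zero (S : Problem V W) (j : ℕ) : S.step j 0 = (S.b j, 0) := by
  simp [Problem.step, analysisMean, analysisCov, gain]

theorem norm_step_le {L : ℝ} (hL : 1 ≤ L) (hj : 1 ≤ j) (hS : S.BoundedAt j L)
    {z : V × (V →L[ℝ] V)} (hz : z.2.IsPositive) :
    ‖S.step j z‖ ≤ L + 8 * L ^ 14 * (‖z‖ + ‖z‖ ^ 2) := by
  have h := norm_step_sub_step_le (z' := 0) hL hj hS hz ContinuousLinearMap.isPositive_zero (by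
    rw [norm_zero]
    positivity)
  rw [sub_zero] at h
  have h0 : ‖S.step j 0‖ ≤ L := by
    rw [step_zero]
    exact max_le hS.b (norm_zero.trans_le (by positivity))
  exact (norm_le_norm_add_norm_sub' _ (S.step j 0)).trans (add_le_add h0 h)

/-- A bound for the mean and the covariance of the Kalman filter at time `k` when all the inputs,
the initial mean and the initial covariance are bounded by `L`. -/
def normBound (L : ℝ) : ℕ → ℝ
  | 0 => L
  | k + 1 => L + 8 * L ^ 14 * (normBound L k + normBound L k ^ 2)

theorem le_normBound {L : ℝ} (hL : 1 ≤ L) : ∀ k, L ≤ normBound L k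
  | 0 => le_rfl
  | k + 1 => by
    have : 0 ≤ normBound L k := (zero_le_one.trans hL).trans (le_normBound hL k)
    exact le_add_of_nonneg_right (by positivity)

theorem norm_kalman_le {L : ℝ} (hL : 1 ≤ L) (hS : ∀ j, 1 ≤ j → j ≤ k → S.BoundedAt j L) {m : V}
    {B : V →L[ℝ] V} (hm : ‖m‖ ≤ L) (hBL : ‖B‖ ≤ L) (hB : B.IsPositive) :
    ‖kalman S m B k‖ ≤ normBound L k := by
  induction k with
  | zero => exact max_le hm hBL
  | succ k ih =>
    have hk := ih fun j hj hjk => hS j hj (hjk.trans k.le_succ)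
    calc ‖kalman S m B (k + 1)‖
        ≤ L + 8 * L ^ 14 * (‖kalman S m B k‖ + ‖kalman S m B k‖ ^ 2) :=
          norm_step_le hL k.succ_pos (hS _ k.succ_pos le_rfl) (isPositive_kalman_snd S m hB k)
      _ ≤ normBound L (k + 1) := by
          rw [normBound]
          gcongr

end Step

section EnsembleStatistics

variable {V : Type*} [NormedAddCommGroup V] [InnerProductSpace ℝ V] {N : ℕ}

theorem inv_smul_sum_sub (hN : N ≠ 0) (x : Fin N → V) (m : V) :
    (N : ℝ)⁻¹ • ∑ i, (x i - m) = ensMean x - m := by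
  rw [Finset.sum_sub_distrib, Finset.sum_const, Finset.card_univ, Fintype.card_fin, smul_sub,
    ← Nat.cast_smul_eq_nsmul ℝ, inv_smul_smul₀ (Nat.cast_ne_zero.2 hN), ensMean]

theorem ensMean_affine (hN : N ≠ 0) (M : V →L[ℝ] V) (b : V) (x : Fin N → V) :
    ensMean (fun i => M (x i) + b) = M (ensMean x) + b := by
  simp only [ensMean, Finset.sum_add_distrib, Finset.sum_const, Finset.card_univ,
    Fintype.card_fin, smul_add, ← Nat.cast_smul_eq_nsmul ℝ,
    inv_smul_smul₀ (Nat.cast_ne_zero (R := ℝ).2 hN), map_smul, map_sum]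

theorem isPositive_ensCov (x : Fin N → V) : (ensCov x).IsPositive :=
  (ContinuousLinearMap.isPositive_sum _ fun _ _ =>
    InnerProductSpace.isPositive_rankOne_self _).smul_of_nonneg (by positivity)

theorem ensCov_affine [CompleteSpace V] (hN : N ≠ 0) (M : V →L[ℝ] V) (b : V) (x : Fin N → V) :
    ensCov (fun i => M (x i) + b) = M ∘L ensCov x ∘L M.adjoint := by
  ext u
  simp only [ensCov, ensMean_affine hN, add_sub_add_right_eq_sub, ← map_sub, smul_apply,
    sum_apply, InnerProductSpace.rankOne_apply, ContinuousLinearMap.comp_apply, map_smul, map_sum,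
    ContinuousLinearMap.adjoint_inner_right]

theorem ensCov_eq_sub_rankOne (hN : N ≠ 0) (x : Fin N → V) (m : V) :
    ensCov x = (N : ℝ)⁻¹ • ∑ i, InnerProductSpace.rankOne ℝ (x i - m) (x i - m) -
      InnerProductSpace.rankOne ℝ (ensMean x - m) (ensMean x - m) := by
  have hmean := inv_smul_sum_sub hN x m
  set e := ensMean x - m with he
  have hexpand (i : Fin N) :
      InnerProductSpace.rankOne ℝ (x i - ensMean x) (x i - ensMean x) =
        InnerProductSpace.rankOne ℝ (x i - m) (x i - m) -
          InnerProductSpace.rankOne ℝ (x i - m) e - InnerProductSpace.rankOne ℝ e (x i - m) +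
          InnerProductSpace.rankOne ℝ e e := by
    rw [← sub_sub_sub_cancel_right (x i) (ensMean x) m, ← he]
    simp only [map_sub, sub_apply]
    abel
  have hleft : (N : ℝ)⁻¹ • ∑ i, InnerProductSpace.rankOne ℝ (x i - m) e =
      InnerProductSpace.rankOne ℝ e e := by
    nth_rw 2 [← hmean]
    simp only [map_smul, map_sum, smul_apply, sum_apply]
  have hright : (N : ℝ)⁻¹ • ∑ i, InnerProductSpace.rankOne ℝ e (x i - m) =
      InnerProductSpace.rankOne ℝ e e := by
    rw [← map_sum, ← map_smul, hmean]
  simp only [ensCov, hexpand, Finset.sum_add_distrib, Finset.sum_sub_distrib, smul_add, smul_sub,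
    hleft, hright, Finset.sum_const, Finset.card_univ, Fintype.card_fin,
    ← Nat.cast_smul_eq_nsmul ℝ, inv_smul_smul₀ (Nat.cast_ne_zero (R := ℝ).2 hN)]
  abel

/-- The mean and the covariance of an ensemble. -/
def ensStat (x : Fin N → V) : V × (V →L[ℝ] V) := (ensMean x, ensCov x)

theorem norm_rankOne_self (x : V) : ‖InnerProductSpace.rankOne ℝ x x‖ = ‖x‖ ^ 2 := by
  rw [InnerProductSpace.norm_rankOne, sq]

theorem norm_ensStat_sub_le (hN : N ≠ 0) (x : Fin N → V) (m : V) (A : V →L[ℝ] V) :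
    ‖ensStat x - (m, A)‖ ≤ ‖ensMean x - m‖ + ‖ensMean x - m‖ ^ 2 +
      ‖(N : ℝ)⁻¹ • ∑ i, InnerProductSpace.rankOne ℝ (x i - m) (x i - m) - A‖ := by
  have hcov : ‖ensCov x - A‖ ≤
      ‖(N : ℝ)⁻¹ • ∑ i, InnerProductSpace.rankOne ℝ (x i - m) (x i - m) - A‖ +
        ‖ensMean x - m‖ ^ 2 := by
    rw [ensCov_eq_sub_rankOne hN x m, sub_right_comm, ← norm_rankOne_self]
    exact norm_sub_le _ _
  have h₁ := norm_nonneg (ensMean x - m)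
  refine max_le ?_ (hcov.trans (by linarith))
  exact le_add_of_le_of_nonneg (le_add_of_nonneg_right (by positivity)) (norm_nonneg _)

theorem continuous_rankOne_self : Continuous fun x : V => InnerProductSpace.rankOne ℝ x x :=
  (InnerProductSpace.rankOne ℝ : V →L[ℝ] V →L⋆[ℝ] V →L[ℝ] V).continuous.clm_apply continuous_id

theorem continuous_ensStat : Continuous (ensStat : (Fin N → V) → V × (V →L[ℝ] V)) := by
  have hmean : Continuous (ensMean : (Fin N → V) → V) :=
    (continuous_finsetSum _ fun i _ => continuous_apply i).const_smul _
  have hdev (i : Fin N) : Continuous fun x : Fin N → V => x i - ensMean x :=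
    (continuous_apply i).sub hmean
  have hcov : Continuous (ensCov : (Fin N → V) → V →L[ℝ] V) :=
    (continuous_finsetSum _ fun i _ => continuous_rankOne_self.comp (hdev i)).const_smul (N : ℝ)⁻¹
  exact hmean.prodMk hcov

theorem aestronglyMeasurable_ensStat [TopologicalSpace.SeparableSpace V] [MeasurableSpace V]
    [BorelSpace V] {Ω : Type*} [MeasurableSpace Ω] {P : Measure Ω} {X : Fin N → Ω → V}
    (hX : ∀ i, AEMeasurable (X i) P) :
    AEStronglyMeasurable (fun ω => ensStat fun i => X i ω) P := by
  have : SecondCountableTopology V := UniformSpace.secondCountable_of_separable V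
  exact continuous_ensStat.comp_aestronglyMeasurable
    (aemeasurable_pi_lambda _ hX).aestronglyMeasurable

variable {W Ω : Type*} [MeasurableSpace V] [NormedAddCommGroup W] [InnerProductSpace ℝ W]
  [CompleteSpace V] [CompleteSpace W] [MeasurableSpace Ω] {S : Problem V W} {μ₀ : Measure V}
  {P : Measure Ω} {X : ℕ → Fin N → Ω → V}

theorem IsUnbiasedSqrtFilter.ensStat_succ (hX : IsUnbiasedSqrtFilter S μ₀ P X) (hN : N ≠ 0)
    (k : ℕ) :
    ∀ᵐ ω ∂P, ensStat (fun i => X (k + 1) i ω) = S.step (k + 1) (ensStat fun i => X k i ω) := by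
  filter_upwards [hX.mean k, hX.cov k] with ω hmean hcov
  simp only [ensMean_affine hN, ensCov_affine hN] at hmean hcov
  exact Prod.ext hmean hcov

end EnsembleStatistics

section Propagation

theorem eLpNorm_le_of_norm_le_add_sq {Ω E F : Type*} [MeasurableSpace Ω] [NormedAddCommGroup E]
    [NormedAddCommGroup F] {P : Measure Ω} [IsProbabilityMeasure P] {f : Ω → E} {g : Ω → F}
    (hf : AEStronglyMeasurable f P) {c D δ : ℝ} (hc : 0 ≤ c) (hδ₀ : 0 ≤ δ)
    (hδ₁ : δ ≤ 1) {q : ENNReal} (hq : 1 ≤ q)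
    (hgf : ∀ᵐ ω ∂P, ‖g ω‖ ≤ c * (‖f ω‖ + ‖f ω‖ ^ 2))
    (hD : 0 ≤ D) (hfD : eLpNorm f (2 * q) P ≤ ENNReal.ofReal (D * δ)) :
    eLpNorm g q P ≤ ENNReal.ofReal (c * (D + D ^ 2) * δ) := by
  have hlin : eLpNorm (fun ω => ‖f ω‖) q P ≤ ENNReal.ofReal (D * δ) := by
    rw [eLpNorm_norm]
    exact (eLpNorm_le_eLpNorm_of_exponent_le (le_mul_of_one_le_left' one_le_two) hf).trans hfD
  have hsq : eLpNorm (fun ω => ‖f ω‖ ^ 2) q P ≤ ENNReal.ofReal ((D * δ) ^ 2) := by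
    rw [eLpNorm_of_norm_eq_sq (fun ω => Real.norm_of_nonneg (sq_nonneg ‖f ω‖)),
      ENNReal.ofReal_pow (by positivity)]
    gcongr
  calc eLpNorm g q P
      ≤ ENNReal.ofReal c * eLpNorm (fun ω => ‖f ω‖ + ‖f ω‖ ^ 2) q P :=
        eLpNorm_le_mul_eLpNorm_of_ae_le_mul
          (hgf.mono fun ω hω => hω.trans (by gcongr; exact le_abs_self _)) q
    _ ≤ ENNReal.ofReal c * (ENNReal.ofReal (D * δ) + ENNReal.ofReal ((D * δ) ^ 2)) := by
        gcongr
        exact (eLpNorm_add_le hf.norm (hf.norm.pow 2) hq).trans (add_le_add hlin hsq)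
    _ = ENNReal.ofReal (c * (D * δ + (D * δ) ^ 2)) := by
        rw [ENNReal.ofReal_mul hc, ENNReal.ofReal_add (by positivity) (by positivity)]
    _ ≤ ENNReal.ofReal (c * (D + D ^ 2) * δ) := by
        refine ENNReal.ofReal_le_ofReal ?_
        calc c * (D * δ + (D * δ) ^ 2) = c * (D + D ^ 2 * δ) * δ := by ring
          _ ≤ c * (D + D ^ 2 * 1) * δ := by gcongr
          _ = c * (D + D ^ 2) * δ := by rw [mul_one]

/-- A bound, relative to `1 / √N`, for the error of an ensemble filter at time `k` when the error at
time `0` is bounded by `D / √N` and the inputs and the initial statistics are bounded by `L`. -/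
def errorConst (L D : ℝ) : ℕ → ℝ
  | 0 => D
  | k + 1 => 8 * normBound L k ^ 14 * (errorConst L D k + errorConst L D k ^ 2)

theorem errorConst_nonneg {L D : ℝ} (hL : 1 ≤ L) (hD : 0 ≤ D) : ∀ k, 0 ≤ errorConst L D k
  | 0 => hD
  | k + 1 => by
    have hC := errorConst_nonneg hL hD k
    have := (zero_le_one.trans hL).trans (le_normBound hL k)
    rw [errorConst]
    positivity

variable {V W Ω : Type*} [NormedAddCommGroup V] [InnerProductSpace ℝ V] [CompleteSpace V]
  [TopologicalSpace.SeparableSpace V] [MeasurableSpace V] [BorelSpace V] [NormedAddCommGroup W]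
  [InnerProductSpace ℝ W] [CompleteSpace W] [MeasurableSpace Ω] {S : Problem V W} {μ₀ : Measure V}
  {P : Measure Ω} [IsProbabilityMeasure P] {N : ℕ} {X : ℕ → Fin N → Ω → V}

theorem IsUnbiasedSqrtFilter.eLpNorm_ensStat_sub_kalman_le (hX : IsUnbiasedSqrtFilter S μ₀ P X)
    (hN : N ≠ 0) {k : ℕ} {L D δ : ℝ} (hL : 1 ≤ L)
    (hS : ∀ j, 1 ≤ j → j ≤ k → S.BoundedAt j L) {m : V} {B : V →L[ℝ] V} (hm : ‖m‖ ≤ L)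
    (hBL : ‖B‖ ≤ L) (hB : B.IsPositive) (hD : 0 ≤ D) (hδ₀ : 0 ≤ δ) (hδ₁ : δ ≤ 1)
    {q : ENNReal} (hq : 1 ≤ q)
    (h0 : eLpNorm (fun ω => ensStat (fun i => X 0 i ω) - (m, B)) (2 ^ k * q) P ≤
      ENNReal.ofReal (D * δ)) :
    eLpNorm (fun ω => ensStat (fun i => X k i ω) - kalman S m B k) q P ≤
      ENNReal.ofReal (errorConst L D k * δ) := by
  induction k generalizing q with
  | zero => simpa only [pow_zero, one_mul, kalman, errorConst] using h0
  | succ k ih =>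
    have hSk (j : ℕ) (hj : 1 ≤ j) (hjk : j ≤ k) := hS j hj (hjk.trans k.le_succ)
    have hLA := le_normBound hL k
    have herror : eLpNorm (fun ω => ensStat (fun i => X k i ω) - kalman S m B k) (2 * q) P ≤
        ENNReal.ofReal (errorConst L D k * δ) := by
      refine ih hSk (hq.trans (le_mul_of_one_le_left' one_le_two)) ?_
      rwa [← mul_assoc, ← pow_succ]
    refine eLpNorm_le_of_norm_le_add_sq
      ((aestronglyMeasurable_ensStat (hX.aemeasurable k)).sub aestronglyMeasurable_const)
      (by have := zero_le_one.trans (hL.trans hLA); positivity) hδ₀ hδ₁ hq ?_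
      (errorConst_nonneg hL hD k) herror
    filter_upwards [hX.ensStat_succ hN k] with ω hω
    rw [hω, kalman_succ]
    exact norm_step_sub_step_le (hL.trans hLA) k.succ_pos ((hS _ k.succ_pos le_rfl).mono hLA)
      (isPositive_ensCov _) (isPositive_kalman_snd S m hB k) (norm_kalman_le hL hSk hm hBL hB)

end Propagation

section SecondMoment

variable {E V : Type*} [MeasurableSpace E] [NormedAddCommGroup V] [InnerProductSpace ℝ V]
  {μ : Measure E} {y : E → V}

theorem memLp_rankOne_self {q : ENNReal} (hy : MemLp y (2 * q) μ) :
    MemLp (fun x => InnerProductSpace.rankOne ℝ (y x) (y x)) q μ :=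
  memLp_of_norm_eq_sq (continuous_rankOne_self.comp_aestronglyMeasurable hy.1)
    (fun _ => norm_rankOne_self _) hy

theorem norm_integral_rankOne_self_le [IsProbabilityMeasure μ] {q : ENNReal} (hq : 1 ≤ q)
    (hy : MemLp y (2 * q) μ) :
    ‖∫ x, InnerProductSpace.rankOne ℝ (y x) (y x) ∂μ‖ ≤ lpNorm y (2 * q) μ ^ 2 := by
  have hyy := memLp_rankOne_self hy
  rw [← lpNorm_of_norm_eq_sq hyy.1 hy.1 fun _ => norm_rankOne_self _]
  exact norm_integral_le_lpNorm hyy hq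

variable [CompleteSpace V]

theorem inner_integral_rankOne_self (hy : MemLp y 2 μ) (u v : V) :
    inner ℝ ((∫ x, InnerProductSpace.rankOne ℝ (y x) (y x) ∂μ) u) v =
      ∫ x, inner ℝ (InnerProductSpace.rankOne ℝ (y x) (y x) u) v ∂μ := by
  have hi : Integrable (fun x => InnerProductSpace.rankOne ℝ (y x) (y x)) μ :=
    memLp_one_iff_integrable.1 (memLp_rankOne_self (by rwa [mul_one]))
  rw [ContinuousLinearMap.integral_apply hi, real_inner_comm,
    ← integral_inner (hi.apply_continuousLinearMap u)]
  simp only [real_inner_comm]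

theorem isPositive_integral_rankOne_self (hy : MemLp y 2 μ) :
    (∫ x, InnerProductSpace.rankOne ℝ (y x) (y x) ∂μ).IsPositive := by
  refine ContinuousLinearMap.isPositive_def.2 ⟨fun u v => ?_, fun u => ?_⟩
  · rw [ContinuousLinearMap.coe_coe, real_inner_comm _ u, inner_integral_rankOne_self hy,
      inner_integral_rankOne_self hy]
    simp only [InnerProductSpace.rankOne_apply, real_inner_smul_left, mul_comm]
  · rw [ContinuousLinearMap.reApplyInnerSelf_apply, inner_integral_rankOne_self hy]
    refine integral_nonneg fun x => ?_
    exact (InnerProductSpace.isPositive_rankOne_self (𝕜 := ℝ) (y x)).re_inner_nonneg_left u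

end SecondMoment

section TensorSquare

open scoped TensorProduct

variable {V : Type*} [NormedAddCommGroup V] [InnerProductSpace ℝ V]

/-- `x ⊗ x` in the Hilbert space tensor square of `V`. Its norm dominates the operator norm, so
that Monte Carlo estimates, which hold in Hilbert spaces, extend to operators. -/
def tensorSq (x : V) : UniformSpace.Completion (V ⊗[ℝ] V) := ↑(x ⊗ₜ[ℝ] x : V ⊗[ℝ] V)

theorem continuous_tensorSq : Continuous (tensorSq : V → _) :=
  (UniformSpace.Completion.continuous_coe _).comp
    ((TensorProduct.mkL ℝ V V).continuous₂.comp (continuous_id.prodMk continuous_id))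

theorem norm_tensorSq (x : V) : ‖tensorSq x‖ = ‖x‖ ^ 2 := by
  rw [tensorSq, UniformSpace.Completion.norm_coe, TensorProduct.norm_tmul, sq]

theorem inner_tensorSq (x u v : V) :
    inner ℝ (tensorSq x) ↑(v ⊗ₜ[ℝ] u : V ⊗[ℝ] V) =
      inner ℝ (InnerProductSpace.rankOne ℝ x x u) v := by
  rw [tensorSq, UniformSpace.Completion.inner_coe, TensorProduct.inner_tmul,
    InnerProductSpace.rankOne_apply, real_inner_smul_left, mul_comm]

theorem opNorm_le_norm_of_inner_eq {T : V →L[ℝ] V} {t : UniformSpace.Completion (V ⊗[ℝ] V)}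
    (h : ∀ u v, inner ℝ t ↑(v ⊗ₜ[ℝ] u : V ⊗[ℝ] V) = inner ℝ (T u) v) : ‖T‖ ≤ ‖t‖ := by
  refine ContinuousLinearMap.opNorm_le_bound _ (norm_nonneg _) fun u => ?_
  have hsq : ‖T u‖ ^ 2 ≤ ‖t‖ * (‖T u‖ * ‖u‖) := by
    have hinner := real_inner_le_norm t ↑(T u ⊗ₜ[ℝ] u : V ⊗[ℝ] V)
    rwa [h, real_inner_self_eq_norm_sq, UniformSpace.Completion.norm_coe,
      TensorProduct.norm_tmul] at hinner
  rcases (norm_nonneg (T u)).eq_or_lt with h0 | h0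
  · rw [← h0]; positivity
  · nlinarith

variable {E : Type*} [MeasurableSpace E] {μ : Measure E} {y : E → V}

theorem memLp_tensorSq {q : ENNReal} (hy : MemLp y (2 * q) μ) :
    MemLp (fun x => tensorSq (y x)) q μ :=
  memLp_of_norm_eq_sq (continuous_tensorSq.comp_aestronglyMeasurable hy.1)
    (fun _ => norm_tensorSq _) hy

theorem norm_sampleMean_rankOne_sub_integral_le [CompleteSpace V] (hy : MemLp y 2 μ) {N : ℕ}
    (x : Fin N → E) :
    ‖(N : ℝ)⁻¹ • ∑ i, InnerProductSpace.rankOne ℝ (y (x i)) (y (x i)) -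
        ∫ x, InnerProductSpace.rankOne ℝ (y x) (y x) ∂μ‖ ≤
      ‖(N : ℝ)⁻¹ • ∑ i, tensorSq (y (x i)) - ∫ x, tensorSq (y x) ∂μ‖ := by
  have hi : Integrable (fun x => tensorSq (y x)) μ :=
    memLp_one_iff_integrable.1 (memLp_tensorSq (by rwa [mul_one]))
  have hint (u v : V) : inner ℝ (∫ x, tensorSq (y x) ∂μ) ↑(v ⊗ₜ[ℝ] u : V ⊗[ℝ] V) =
      inner ℝ ((∫ x, InnerProductSpace.rankOne ℝ (y x) (y x) ∂μ) u) v := by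
    rw [inner_integral_rankOne_self hy, real_inner_comm, ← integral_inner hi]
    refine integral_congr_ae (ae_of_all _ fun x => ?_)
    exact (real_inner_comm _ _).trans (inner_tensorSq (y x) u v)
  refine opNorm_le_norm_of_inner_eq fun u v => ?_
  simp only [sub_apply, smul_apply, sum_apply, inner_sub_left, real_inner_smul_left, sum_inner,
    hint, inner_tensorSq]

theorem eLpNorm_sampleMean_rankOne_sub_integral_le [CompleteSpace V] [IsProbabilityMeasure μ]
    {Ω : Type*} [MeasurableSpace Ω] {P : Measure Ω} [IsProbabilityMeasure P] {N : ℕ} (hN : N ≠ 0)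
    {X : Fin N → Ω → E} (hX : iIndepFun X P) (hlaw : ∀ i, HasLaw (X i) μ P) {n : ℕ} (hn : n ≠ 0)
    (hy : MemLp y (2 * (2 * n : ℕ)) μ) :
    eLpNorm (fun ω => (N : ℝ)⁻¹ • ∑ i, InnerProductSpace.rankOne ℝ (y (X i ω)) (y (X i ω)) -
        ∫ x, InnerProductSpace.rankOne ℝ (y x) (y x) ∂μ) (2 * n : ℕ) P ≤
      ENNReal.ofReal (sampleMeanConst n * lpNorm y (2 * (2 * n : ℕ)) μ ^ 2 / √N) := by
  have hyy := memLp_tensorSq hy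
  have hy2 : MemLp y 2 μ := hy.mono_exponent <|
    le_mul_of_one_le_right' (by exact_mod_cast (by omega : 1 ≤ 2 * n))
  refine (eLpNorm_mono fun ω =>
    norm_sampleMean_rankOne_sub_integral_le hy2 fun i => X i ω).trans ?_
  rw [← lpNorm_of_norm_eq_sq hyy.1 hy.1 fun _ => norm_tensorSq _]
  exact eLpNorm_sampleMean_sub_integral_le hN hX hlaw (y := fun x => tensorSq (y x)) hn hyy

end TensorSquare

section InitialEnsemble

variable {V : Type*} [NormedAddCommGroup V] [InnerProductSpace ℝ V] [MeasurableSpace V]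
  {μ : Measure V} [IsProbabilityMeasure μ]

theorem norm_distCov_le {q : ENNReal} (hq : 1 ≤ q) (hμ : MemLp (fun x : V => x) (2 * q) μ) :
    ‖distCov μ‖ ≤ (2 * lpNorm (fun x : V => x) (2 * q) μ) ^ 2 := by
  refine (norm_integral_rankOne_self_le hq (hμ.sub (memLp_const (distMean μ)))).trans ?_
  gcongr
  · exact lpNorm_nonneg
  · exact lpNorm_sub_integral_le hμ (hq.trans (le_mul_of_one_le_left' one_le_two))

/-- A bound, relative to `1 / √N`, for the error in `L^{2n}` of the statistics of an i.i.d. ensemble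
drawn from a distribution whose `L^{4n}` norm is at most `r`. -/
def sampleStatConst (r : ℝ) (n : ℕ) : ℝ :=
  sampleMeanConst (2 * n) * r + (sampleMeanConst (2 * n) * r) ^ 2 + sampleMeanConst n * (2 * r) ^ 2

theorem sampleStatConst_nonneg {r : ℝ} (hr : 0 ≤ r) (n : ℕ) : 0 ≤ sampleStatConst r n := by
  have h₁ := sampleMeanConst_nonneg n
  have h₂ := sampleMeanConst_nonneg (2 * n)
  rw [sampleStatConst]
  positivity

variable [CompleteSpace V] {Ω : Type*} [MeasurableSpace Ω] {P : Measure Ω}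
  [IsProbabilityMeasure P] {N n : ℕ} {X : Fin N → Ω → V} {r : ℝ}

theorem eLpNorm_sampleMean_rankOne_sub_distCov_le (hN : N ≠ 0) (hX : iIndepFun X P)
    (hlaw : ∀ i, HasLaw (X i) μ P) (hn : n ≠ 0) (hμ : MemLp (fun x : V => x) (2 * (2 * n : ℕ)) μ)
    (hr : lpNorm (fun x : V => x) (2 * (2 * n : ℕ)) μ ≤ r) :
    eLpNorm (fun ω => (N : ℝ)⁻¹ • ∑ i,
        InnerProductSpace.rankOne ℝ (X i ω - distMean μ) (X i ω - distMean μ) - distCov μ)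
      (2 * n : ℕ) P ≤ ENNReal.ofReal (sampleMeanConst n * (2 * r) ^ 2 * (√N)⁻¹) := by
  have hq : (1 : ENNReal) ≤ 2 * (2 * n : ℕ) := by exact_mod_cast (by omega : 1 ≤ 2 * (2 * n))
  refine (eLpNorm_sampleMean_rankOne_sub_integral_le hN hX hlaw hn
    (hμ.sub (memLp_const (distMean μ)))).trans ?_
  rw [div_eq_mul_inv]
  have := sampleMeanConst_nonneg n
  gcongr
  · exact lpNorm_nonneg
  · exact (lpNorm_sub_integral_le hμ hq).trans (by gcongr)

variable [TopologicalSpace.SeparableSpace V] [BorelSpace V]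

theorem eLpNorm_ensMean_sub_distMean_add_sq_le (hN : N ≠ 0) (hX : iIndepFun X P)
    (hlaw : ∀ i, HasLaw (X i) μ P) (hn : n ≠ 0)
    (hμ : MemLp (fun x : V => x) (2 * (2 * n : ℕ)) μ)
    (hr : lpNorm (fun x : V => x) (2 * (2 * n : ℕ)) μ ≤ r) :
    eLpNorm (fun ω => ‖ensMean (fun i => X i ω) - distMean μ‖ +
        ‖ensMean (fun i => X i ω) - distMean μ‖ ^ 2) (2 * n : ℕ) P ≤
      ENNReal.ofReal
        ((sampleMeanConst (2 * n) * r + (sampleMeanConst (2 * n) * r) ^ 2) * (√N)⁻¹) := by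
  have hq : (1 : ENNReal) ≤ (2 * n : ℕ) := by exact_mod_cast (by omega : 1 ≤ 2 * n)
  have hδ : (√(N : ℝ))⁻¹ ≤ 1 := inv_le_one_of_one_le₀ <|
    Real.one_le_sqrt.2 <| by exact_mod_cast Nat.one_le_iff_ne_zero.2 hN
  have hc := sampleMeanConst_nonneg (2 * n)
  have hr0 : 0 ≤ r := lpNorm_nonneg.trans hr
  have hmean : eLpNorm (fun ω => ensMean (fun i => X i ω) - distMean μ) (2 * (2 * n : ℕ)) P ≤
      ENNReal.ofReal (sampleMeanConst (2 * n) * r * (√N)⁻¹) := by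
    have h := eLpNorm_sampleMean_sub_integral_le (n := 2 * n) hN hX hlaw (by omega)
      (by exact_mod_cast hμ)
    push_cast at h hr ⊢
    rw [div_eq_mul_inv] at h
    exact h.trans (by gcongr)
  rw [← one_mul (_ + _ : ℝ)]
  refine eLpNorm_le_of_norm_le_add_sq
    ((aestronglyMeasurable_ensStat fun i => (hlaw i).aemeasurable).fst.sub
      aestronglyMeasurable_const) zero_le_one (by positivity) hδ hq (ae_of_all _ fun ω => ?_)
    (by positivity) hmean
  rw [one_mul, Real.norm_of_nonneg (by positivity)]
  rfl

theorem eLpNorm_ensStat_sub_distStat_le (hN : N ≠ 0) (hX : iIndepFun X P)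
    (hlaw : ∀ i, HasLaw (X i) μ P) (hn : n ≠ 0)
    (hμ : MemLp (fun x : V => x) (2 * (2 * n : ℕ)) μ)
    (hr : lpNorm (fun x : V => x) (2 * (2 * n : ℕ)) μ ≤ r) :
    eLpNorm (fun ω => ensStat (fun i => X i ω) - (distMean μ, distCov μ)) (2 * n : ℕ) P ≤
      ENNReal.ofReal (sampleStatConst r n * (√N)⁻¹) := by
  have hq : (1 : ENNReal) ≤ (2 * n : ℕ) := by exact_mod_cast (by omega : 1 ≤ 2 * n)
  have hr0 : 0 ≤ r := lpNorm_nonneg.trans hr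
  have hc₁ := sampleMeanConst_nonneg n
  have hc₂ := sampleMeanConst_nonneg (2 * n)
  set m := distMean μ
  set e : Ω → V := fun ω => ensMean (fun i => X i ω) - m
  set T : Ω → V →L[ℝ] V := fun ω =>
    (N : ℝ)⁻¹ • ∑ i, InnerProductSpace.rankOne ℝ (X i ω - m) (X i ω - m) - distCov μ
  have hem : AEStronglyMeasurable e P :=
    (aestronglyMeasurable_ensStat fun i => (hlaw i).aemeasurable).fst.sub
      aestronglyMeasurable_const
  have hTm : AEStronglyMeasurable T P := by
    have : SecondCountableTopology V := UniformSpace.secondCountable_of_separable V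
    exact ((Finset.aestronglyMeasurable_fun_sum _ fun i _ =>
      continuous_rankOne_self.comp_aestronglyMeasurable
        ((hlaw i).aemeasurable.aestronglyMeasurable.sub
          aestronglyMeasurable_const)).const_smul (N : ℝ)⁻¹).sub aestronglyMeasurable_const
  calc eLpNorm (fun ω => ensStat (fun i => X i ω) - (m, distCov μ)) (2 * n : ℕ) P
      ≤ eLpNorm (fun ω => (‖e ω‖ + ‖e ω‖ ^ 2) + ‖T ω‖) (2 * n : ℕ) P :=
        eLpNorm_mono fun ω => (norm_ensStat_sub_le hN _ _ _).trans (le_abs_self _)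
    _ ≤ eLpNorm (fun ω => ‖e ω‖ + ‖e ω‖ ^ 2) (2 * n : ℕ) P +
          eLpNorm (fun ω => ‖T ω‖) (2 * n : ℕ) P :=
        eLpNorm_add_le (hem.norm.add (hem.norm.pow 2)) hTm.norm hq
    _ ≤ ENNReal.ofReal
            ((sampleMeanConst (2 * n) * r + (sampleMeanConst (2 * n) * r) ^ 2) * (√N)⁻¹) +
          ENNReal.ofReal (sampleMeanConst n * (2 * r) ^ 2 * (√N)⁻¹) := by
        rw [eLpNorm_norm]
        exact add_le_add (eLpNorm_ensMean_sub_distMean_add_sq_le hN hX hlaw hn hμ hr)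
          (eLpNorm_sampleMean_rankOne_sub_distCov_le hN hX hlaw hn hμ hr)
    _ = ENNReal.ofReal (sampleStatConst r n * (√N)⁻¹) := by
        rw [← ENNReal.ofReal_add (by positivity) (by positivity), ← add_mul, sampleStatConst]

end InitialEnsemble

section Convergence

theorem memLp_natCast_of_integrable_norm_pow {α G : Type*} [MeasurableSpace α]
    [NormedAddCommGroup G] {μ : Measure α} {f : α → G} (hf : AEStronglyMeasurable f μ) {n : ℕ}
    (hn : n ≠ 0) (hfn : Integrable (fun x => ‖f x‖ ^ n) μ) : MemLp f n μ := by
  rw [← integrable_norm_rpow_iff hf (by exact_mod_cast hn) (ENNReal.natCast_ne_top n)]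
  simpa only [ENNReal.toReal_natCast, Real.rpow_natCast] using hfn

theorem lpNorm_natCast_le_of_integral_norm_pow_le {α G : Type*} [MeasurableSpace α]
    [NormedAddCommGroup G] {μ : Measure α} {f : α → G} (hf : AEStronglyMeasurable f μ) {n : ℕ}
    (hn : n ≠ 0) {κ : ℝ} (hκ : ∫ x, ‖f x‖ ^ n ∂μ ≤ κ) : lpNorm f n μ ≤ κ ^ (n : ℝ)⁻¹ := by
  rw [← Real.pow_rpow_inv_natCast lpNorm_nonneg hn, lpNorm_natCast_pow hf hn]
  exact Real.rpow_le_rpow (integral_nonneg fun _ => by positivity) hκ (by positivity)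

theorem tendsto_zero_of_le_div_sqrt {u : ℕ → ENNReal} {C : ℝ}
    (hu : ∀ N : ℕ, 1 ≤ N → u N ≤ ENNReal.ofReal (C / √N)) : Tendsto u atTop (𝓝 0) := by
  have hC : Tendsto (fun N : ℕ => ENNReal.ofReal (C / √N)) atTop (𝓝 0) := by
    rw [← ENNReal.ofReal_zero]
    exact ENNReal.tendsto_ofReal (tendsto_const_nhds.div_atTop
      (Real.tendsto_sqrt_atTop.comp tendsto_natCast_atTop_atTop))
  exact tendsto_of_tendsto_of_tendsto_of_le_of_le' tendsto_const_nhds hC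
    (Eventually.of_forall fun _ => zero_le) ((eventually_ge_atTop 1).mono hu)

theorem exists_one_le_forall_boundedAt (cM cb cH cR cd : ℕ → ℝ) (a : ℝ) (k : ℕ) :
    ∃ L : ℝ, 1 ≤ L ∧ a ≤ L ∧ ∀ (V W : Type*) [NormedAddCommGroup V] [InnerProductSpace ℝ V]
      [NormedAddCommGroup W] [InnerProductSpace ℝ W] (S : Problem V W) (j : ℕ), j ≤ k →
        ‖S.M j‖ ≤ cM j ∧ ‖S.b j‖ ≤ cb j ∧ ‖S.H j‖ ≤ cH j ∧
          ‖Ring.inverse (S.R j)‖ ≤ cR j ∧ ‖S.d j‖ ≤ cd j → S.BoundedAt j L := by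
  obtain ⟨A, hA⟩ := ((Set.finite_Iic k).image (cM ⊔ cb ⊔ cH ⊔ cR ⊔ cd)).bddAbove
  refine ⟨max A (max 1 a), by simp, by simp, fun V W _ _ _ _ S j hj ⟨hM, hb, hH, hR, hd⟩ => ?_⟩
  have hAj := (hA ⟨j, hj, rfl⟩).trans (le_max_left A (max 1 a))
  simp only [Pi.sup_apply, sup_le_iff] at hAj
  obtain ⟨⟨⟨⟨hM', hb'⟩, hH'⟩, hR'⟩, hd'⟩ := hAj
  exact ⟨hM.trans hM', hb.trans hb', hH.trans hH', hR.trans hR', hd.trans hd'⟩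

variable {V W Ω : Type*} [NormedAddCommGroup V] [InnerProductSpace ℝ V] [CompleteSpace V]
  [TopologicalSpace.SeparableSpace V] [MeasurableSpace V] [BorelSpace V] [NormedAddCommGroup W]
  [InnerProductSpace ℝ W] [CompleteSpace W] [MeasurableSpace Ω] {S : Problem V W} {μ₀ : Measure V}
  {P : Measure Ω} [IsProbabilityMeasure P] {N : ℕ} {X : ℕ → Fin N → Ω → V} {k n : ℕ} {r L : ℝ}

theorem IsUnbiasedSqrtFilter.memLp_and_eLpNorm_le (hX : IsUnbiasedSqrtFilter S μ₀ P X)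
    {z : V × (V →L[ℝ] V)} {q q' : ENNReal} (hq : q ≤ q') {C : ℝ}
    (hC : eLpNorm (fun ω => ensStat (fun i => X k i ω) - z) q' P ≤ ENNReal.ofReal C) :
    MemLp (fun ω => ensMean (fun i => X k i ω) - z.1) q P ∧
      eLpNorm (fun ω => ensMean (fun i => X k i ω) - z.1) q P ≤ ENNReal.ofReal C ∧
      MemLp (fun ω => ensCov (fun i => X k i ω) - z.2) q P ∧
      eLpNorm (fun ω => ensCov (fun i => X k i ω) - z.2) q P ≤ ENNReal.ofReal C := by
  have hm : AEStronglyMeasurable (fun ω => ensStat (fun i => X k i ω) - z) P :=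
    (aestronglyMeasurable_ensStat (hX.aemeasurable k)).sub aestronglyMeasurable_const
  have hCq := (eLpNorm_le_eLpNorm_of_exponent_le hq hm).trans hC
  have hmean : eLpNorm (fun ω => ensMean (fun i => X k i ω) - z.1) q P ≤ ENNReal.ofReal C :=
    (eLpNorm_mono fun ω => norm_fst_le (ensStat (fun i => X k i ω) - z)).trans hCq
  have hcov : eLpNorm (fun ω => ensCov (fun i => X k i ω) - z.2) q P ≤ ENNReal.ofReal C :=
    (eLpNorm_mono fun ω => norm_snd_le (ensStat (fun i => X k i ω) - z)).trans hCq
  exact ⟨⟨hm.fst, hmean.trans_lt ENNReal.ofReal_lt_top⟩, hmean,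
    ⟨hm.snd, hcov.trans_lt ENNReal.ofReal_lt_top⟩, hcov⟩

variable [IsProbabilityMeasure μ₀]

theorem IsUnbiasedSqrtFilter.eLpNorm_ensStat_sub_kalman_le_div_sqrt
    (hX : IsUnbiasedSqrtFilter S μ₀ P X) (hN : N ≠ 0) (hn : n ≠ 0)
    (hμ : MemLp (fun x : V => x) (2 * (2 * (2 ^ k * n) : ℕ)) μ₀)
    (hr : lpNorm (fun x : V => x) (2 * (2 * (2 ^ k * n) : ℕ)) μ₀ ≤ r)
    (hL : 1 ≤ L) (hrL : max r ((2 * r) ^ 2) ≤ L) (hS : ∀ j, 1 ≤ j → j ≤ k → S.BoundedAt j L) :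
    eLpNorm (fun ω => ensStat (fun i => X k i ω) - kalman S (distMean μ₀) (distCov μ₀) k)
      (2 * n : ℕ) P ≤ ENNReal.ofReal (errorConst L (sampleStatConst r (2 ^ k * n)) k / √N) := by
  have hm : 2 ^ k * n ≠ 0 := by positivity
  have hq : (1 : ENNReal) ≤ (2 * (2 ^ k * n) : ℕ) := by
    exact_mod_cast (by omega : 1 ≤ 2 * (2 ^ k * n))
  have hq₂ := hq.trans (le_mul_of_one_le_left' one_le_two)
  have hr0 : 0 ≤ r := lpNorm_nonneg.trans hr
  have hmean : ‖distMean μ₀‖ ≤ L :=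
    (norm_integral_le_lpNorm hμ hq₂).trans (hr.trans ((le_max_left _ _).trans hrL))
  have hcov : ‖distCov μ₀‖ ≤ L :=
    calc ‖distCov μ₀‖ ≤ (2 * lpNorm (fun x : V => x) (2 * (2 * (2 ^ k * n) : ℕ)) μ₀) ^ 2 :=
          norm_distCov_le hq hμ
      _ ≤ (2 * r) ^ 2 := pow_le_pow_left₀ (mul_nonneg zero_le_two lpNorm_nonneg) (by gcongr) 2
      _ ≤ L := (le_max_right _ _).trans hrL
  have hdev : MemLp (fun x => x - distMean μ₀) 2 μ₀ :=
    (hμ.mono_exponent (le_mul_of_one_le_right' hq)).sub (memLp_const _)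
  have hpos : (distCov μ₀).IsPositive := isPositive_integral_rankOne_self hdev
  have hδ : (√(N : ℝ))⁻¹ ≤ 1 := inv_le_one_of_one_le₀ <|
    Real.one_le_sqrt.2 <| by exact_mod_cast Nat.one_le_iff_ne_zero.2 hN
  rw [div_eq_mul_inv]
  refine hX.eLpNorm_ensStat_sub_kalman_le hN hL hS hmean hcov hpos
    (sampleStatConst_nonneg hr0 _) (by positivity) hδ
    (by exact_mod_cast (by omega : 1 ≤ 2 * n)) ?_
  rw [(by push_cast; ring : (2 : ENNReal) ^ k * (2 * n : ℕ) = (2 * (2 ^ k * n) : ℕ))]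
  exact eLpNorm_ensStat_sub_distStat_le hN hX.indep hX.law hm hμ hr

end Convergence

end EnsembleFilter

end

theorem theorem6p1_general (p : ℝ) (hp : 0 < p) (k : ℕ) (cM cb cH cR cd : ℕ → ℝ) (κ : ℝ) :
    ∃ C : ℝ,
      ∀ (V : Type*) [NormedAddCommGroup V] [InnerProductSpace ℝ V] [CompleteSpace V]
        [TopologicalSpace.SeparableSpace V] [MeasurableSpace V] [BorelSpace V]
        (W : Type*) [NormedAddCommGroup W] [InnerProductSpace ℝ W] [CompleteSpace W]
        (S : EnsembleFilter.Problem V W) (μ₀ : Measure V) [IsProbabilityMeasure μ₀],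
        Integrable (fun x : V => ‖x‖ ^ (2 ^ (k + 2) * ⌈p⌉₊)) μ₀ →
        ∫ x : V, ‖x‖ ^ (2 ^ (k + 2) * ⌈p⌉₊) ∂μ₀ ≤ κ →
        (∀ j : ℕ, 1 ≤ j → j ≤ k →
          ‖S.M j‖ ≤ cM j ∧ ‖S.b j‖ ≤ cb j ∧ ‖S.H j‖ ≤ cH j ∧
            ‖Ring.inverse (S.R j)‖ ≤ cR j ∧ ‖S.d j‖ ≤ cd j) →
        let KF : V × (V →L[ℝ] V) :=
          EnsembleFilter.kalman S (EnsembleFilter.distMean μ₀) (EnsembleFilter.distCov μ₀) k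
        (∀ (Ω : Type*) [MeasurableSpace Ω] (P : Measure Ω) [IsProbabilityMeasure P]
          (N : ℕ) (X : ℕ → Fin N → Ω → V), 1 ≤ N →
          EnsembleFilter.IsUnbiasedSqrtFilter S μ₀ P X →
            MemLp (fun ω => EnsembleFilter.ensMean (fun i => X k i ω) - KF.1)
              (ENNReal.ofReal p) P ∧
            eLpNorm (fun ω => EnsembleFilter.ensMean (fun i => X k i ω) - KF.1)
              (ENNReal.ofReal p) P ≤ ENNReal.ofReal (C / √(N : ℝ)) ∧
            MemLp (fun ω => EnsembleFilter.ensCov (fun i => X k i ω) - KF.2)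
              (ENNReal.ofReal p) P ∧
            eLpNorm (fun ω => EnsembleFilter.ensCov (fun i => X k i ω) - KF.2)
              (ENNReal.ofReal p) P ≤ ENNReal.ofReal (C / √(N : ℝ))) ∧
        (∀ (Ω : ℕ → Type*) [∀ N, MeasurableSpace (Ω N)] (P : ∀ N, Measure (Ω N))
          [∀ N, IsProbabilityMeasure (P N)] (X : ∀ N : ℕ, ℕ → Fin N → Ω N → V),
          (∀ N : ℕ, 1 ≤ N → EnsembleFilter.IsUnbiasedSqrtFilter S μ₀ (P N) (X N)) →
            Tendsto (fun N => eLpNorm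
              (fun ω => EnsembleFilter.ensMean (fun i => X N k i ω) - KF.1)
              (ENNReal.ofReal p) (P N)) atTop (𝓝 0) ∧
            Tendsto (fun N => eLpNorm
              (fun ω => EnsembleFilter.ensCov (fun i => X N k i ω) - KF.2)
              (ENNReal.ofReal p) (P N)) atTop (𝓝 0)) := by
  have hn : ⌈p⌉₊ ≠ 0 := (Nat.ceil_pos.2 hp).ne'
  have hq : ENNReal.ofReal p ≤ (2 * ⌈p⌉₊ : ℕ) := by
    rw [← ENNReal.ofReal_natCast]
    refine ENNReal.ofReal_le_ofReal ((Nat.le_ceil p).trans ?_)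
    exact_mod_cast Nat.le_mul_of_pos_left _ two_pos
  have hexp : ((2 ^ (k + 2) * ⌈p⌉₊ : ℕ) : ENNReal) = 2 * (2 * (2 ^ k * ⌈p⌉₊) : ℕ) := by
    push_cast; ring
  set r := κ ^ ((2 ^ (k + 2) * ⌈p⌉₊ : ℕ) : ℝ)⁻¹
  obtain ⟨L, hL, hrL, hbounded⟩ := EnsembleFilter.exists_one_le_forall_boundedAt
    cM cb cH cR cd (max r ((2 * r) ^ 2)) k
  refine ⟨EnsembleFilter.errorConst L (EnsembleFilter.sampleStatConst r (2 ^ k * ⌈p⌉₊)) k, ?_⟩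
  intro V _ _ _ _ _ _ W _ _ _ S μ₀ _ hint hκ hS
  have : SecondCountableTopology V := UniformSpace.secondCountable_of_separable V
  have hμ := EnsembleFilter.memLp_natCast_of_integrable_norm_pow
    (aestronglyMeasurable_id (α := V)) (by positivity) hint
  have hr := EnsembleFilter.lpNorm_natCast_le_of_integral_norm_pow_le
    (aestronglyMeasurable_id (α := V)) (by positivity) hκ
  rw [hexp] at hμ hr
  have hS' (j : ℕ) (hj : 1 ≤ j) (hjk : j ≤ k) := hbounded V W S j hjk (hS j hj hjk)
  refine ⟨fun Ω _ P _ N X hN hX => hX.memLp_and_eLpNorm_le hq <|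
    hX.eLpNorm_ensStat_sub_kalman_le_div_sqrt (by omega) hn hμ hr hL hrL hS', ?_⟩
  intro Ω _ P _ X hX
  have herror (N : ℕ) (hN : 1 ≤ N) := (hX N hN).memLp_and_eLpNorm_le hq <|
    (hX N hN).eLpNorm_ensStat_sub_kalman_le_div_sqrt (by omega) hn hμ hr hL hrL hS'
  exact ⟨EnsembleFilter.tendsto_zero_of_le_div_sqrt fun N hN => (herror N hN).2.1,
    EnsembleFilter.tendsto_zero_of_le_div_sqrt fun N hN => (herror N hN).2.2.2⟩

theorem theorem6p1 (p : ℝ) (hp : 1 ≤ p) (k : ℕ)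
    -- bounds for the norms of the inputs at each time and for the moments of the initial
    -- distribution: the constant depends on these, on `p` and on `k` only
    (cM cb cH cR cd : ℕ → ℝ) (cmom : ℝ → ℝ) :
    ∃ C : ℝ,
      ∀ (V : Type*) [NormedAddCommGroup V] [InnerProductSpace ℝ V] [CompleteSpace V]
        [TopologicalSpace.SeparableSpace V] [MeasurableSpace V] [BorelSpace V]
        (W : Type*) [NormedAddCommGroup W] [InnerProductSpace ℝ W] [CompleteSpace W]
        [TopologicalSpace.SeparableSpace W]
        (S : EnsembleFilter.Problem V W) (μ₀ : Measure V) [IsProbabilityMeasure μ₀],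
        (∀ q : ℝ, 1 ≤ q → Integrable (fun x : V => ‖x‖ ^ q) μ₀) →
        (∀ q : ℝ, 1 ≤ q → ∫ x : V, ‖x‖ ^ q ∂μ₀ ≤ cmom q) →
        (∀ j : ℕ, 1 ≤ j → j ≤ k →
          ‖S.M j‖ ≤ cM j ∧ ‖S.b j‖ ≤ cb j ∧ ‖S.H j‖ ≤ cH j ∧
            ‖Ring.inverse (S.R j)‖ ≤ cR j ∧ ‖S.d j‖ ≤ cd j) →
        -- `KF` is the pair of the Kalman filter analysis mean and covariance at time `k`
        let KF : V × (V →L[ℝ] V) :=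
          EnsembleFilter.kalman S (EnsembleFilter.distMean μ₀) (EnsembleFilter.distCov μ₀) k
        -- the error estimates for every ensemble size
        (∀ (Ω : Type*) [MeasurableSpace Ω] (P : Measure Ω) [IsProbabilityMeasure P]
          (N : ℕ) (X : ℕ → Fin N → Ω → V), 1 ≤ N →
          EnsembleFilter.IsUnbiasedSqrtFilter S μ₀ P X →
            MemLp (fun ω => EnsembleFilter.ensMean (fun i => X k i ω) - KF.1)
              (ENNReal.ofReal p) P ∧
            eLpNorm (fun ω => EnsembleFilter.ensMean (fun i => X k i ω) - KF.1)
              (ENNReal.ofReal p) P ≤ ENNReal.ofReal (C / √(N : ℝ)) ∧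
            MemLp (fun ω => EnsembleFilter.ensCov (fun i => X k i ω) - KF.2)
              (ENNReal.ofReal p) P ∧
            eLpNorm (fun ω => EnsembleFilter.ensCov (fun i => X k i ω) - KF.2)
              (ENNReal.ofReal p) P ≤ ENNReal.ofReal (C / √(N : ℝ))) ∧
        -- convergence as the ensemble size grows
        (∀ (Ω : ℕ → Type*) [∀ N, MeasurableSpace (Ω N)] (P : ∀ N, Measure (Ω N))
          [∀ N, IsProbabilityMeasure (P N)] (X : ∀ N : ℕ, ℕ → Fin N → Ω N → V),
          (∀ N : ℕ, 1 ≤ N → EnsembleFilter.IsUnbiasedSqrtFilter S μ₀ (P N) (X N)) →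
            Tendsto (fun N => eLpNorm
              (fun ω => EnsembleFilter.ensMean (fun i => X N k i ω) - KF.1)
              (ENNReal.ofReal p) (P N)) atTop (𝓝 0) ∧
            Tendsto (fun N => eLpNorm
              (fun ω => EnsembleFilter.ensCov (fun i => X N k i ω) - KF.2)
              (ENNReal.ofReal p) (P N)) atTop (𝓝 0)) := by
  have hq : (1 : ℝ) ≤ (2 ^ (k + 2) * ⌈p⌉₊ : ℕ) := by
    exact_mod_cast Nat.one_le_iff_ne_zero.2 (by positivity)
  have hgeneral := theorem6p1_general p (by linarith) k cM cb cH cR cd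
    (cmom (2 ^ (k + 2) * ⌈p⌉₊ : ℕ))
  exact hgeneral.imp fun C hC V _ _ _ _ _ _ W _ _ _ _ S μ₀ _ hint hcmom => hC V W S μ₀
    (by simpa only [Real.rpow_natCast] using hint _ hq)
    (by simpa only [Real.rpow_natCast] using hcmom _ hq)
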